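/- Let $I_1,\dots,I_d\subset\mathbb R$ be open intervals (bounded or unbounded), $\mathbf I=I_1\times\dots\times I_d$, and let $\mathbf n=(n_1,\dots,n_d)$ be integers with $n_i\ge 2$ for all $i$. Definitions. For pairwise distinct reals, $[x_0;g]=g(x_0)$ and $[x_0,\dots,x_{m+1};g]=\dfrac{[x_1,\dots,x_{m+1};g]-[x_0,\dots,x_m;g]}{x_{m+1}-x_0}$ are the divided differences of a function $g$ of one variable. For $f\colon\mathbf I\to\mathbb R$ and vectors $\mathbf x_i=(x_{i0},\dots,x_{in_i})\in I_i^{n_i+1}$ with pairwise distinct coordinates, the multiple divided difference $[\mathbf x_1;\dots;\mathbf x_d;f]$ is obtained by applying the divided differences with nodes $\mathbf x_1,\dots,\mathbf x_d$ successively to the 1st, …, $d$-th argument of $f$. The function $f$ is box-$\mathbf n$-convex if $[\mathbf x_1;\dots;\mathbf x_d;f]\ge 0$ for all such $\mathbf x_1,\dots,\mathbf x_d$. A function $W\colon\mathbf I\to\mathbb R$ is a pseudo-polynomial of degree $(m_1,\dots,m_d)$ if $W(\mathbf x)=\sum_{i=1}^d\sum_{k=0}^{m_i}A_{ik}(x_1,\dots,x_{i-1},x_{i+1},\dots,x_d)\,x_i^k$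 for some arbitrary real functions $A_{ik}$. Put $x_+=\max\{0,x\}$, $x_-=\max\{0,-x\}$, and, for $A\subset\{1,\dots,d\}$ and $\boldsymbol\alpha\in\mathbf I$, $\mathbf I_{A,\boldsymbol\alpha}=\{\mathbf u\in\mathbf I: u_j\le\alpha_j \text{ for } j\in A,\ u_j>\alpha_j\text{ for } j\notin A\}$. Theorem. A function $f\colon\mathbf I\to\mathbb R$ is box-$\mathbf n$-convex if and only if for every $\boldsymbol\alpha=(\alpha_1,\dots,\alpha_d)\in\mathbf I$ there exist a pseudo-polynomial $W_{\boldsymbol\alpha}\colon\mathbf I\to\mathbb R$ of degree $(n_1-1,\dots,n_d-1)$ and a Borel measure $\mu$ on $\mathbf I$, finite on compact subsets of $\mathbf I$, such that for all $\mathbf x=(x_1,\dots,x_d)\in\mathbf I$ $$f(\mathbf x)=W_{\boldsymbol\alpha}(\mathbf x)+\sum_{A\subset\{1,\dots,d\}}\ \int_{\mathbf I_{A,\boldsymbol\alpha}}\ \prod_{j\notin A}\frac{(x_j-u_j)_+^{n_j-1}}{(n_j-1)!}\ \prod_{j\in A}(-1)^{n_j}\frac{(x_j-u_j)_-^{n_j-1}}{(n_j-1)!}\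 d\mu(u_1,\dots,u_d).$$ -/

import Mathlib

open MeasureTheory

namespace BoxConvexity

/-- The divided difference `[x₀, x₁, …, xₙ; f]` of a function of one real variable. -/
noncomputable def dividedDiff : (n : ℕ) → (Fin (n + 1) → ℝ) → (ℝ → ℝ) → ℝ
  | 0, x, f => f (x 0)
  | n + 1, x, f =>
      (dividedDiff n (fun j => x j.succ) f - dividedDiff n (fun j => x j.castSucc) f) /
        (x (Fin.last (n + 1)) - x 0)

/-- The multiple divided difference of order `(n₁, …, n_d)`: the divided difference with nodes
`x_d` is applied to the function `t ↦ [x₁; …; x_{d-1}; f(·, t)]`. For `d = 0` it is the value of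
the constant `f`. -/
noncomputable def multiDividedDiff : {d : ℕ} → (n : Fin d → ℕ) →
    ((i : Fin d) → Fin (n i + 1) → ℝ) → ((Fin d → ℝ) → ℝ) → ℝ
  | 0, _, _, f => f Fin.elim0
  | d + 1, n, x, f =>
      dividedDiff (n (Fin.last d)) (x (Fin.last d)) fun t =>
        multiDividedDiff (fun i : Fin d => n i.castSucc) (fun i : Fin d => x i.castSucc)
          fun y : Fin d → ℝ => f (Fin.snoc (α := fun _ => ℝ) y t)

/-- The box `I₁ × ⋯ × I_d`. -/
def box {d : ℕ} (I : Fin d → Set ℝ) : Set (Fin d → ℝ) := {x | ∀ i, x i ∈ I i}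

/-- `f` is box-`n`-convex on `I₁ × ⋯ × I_d`: all its multiple divided differences of order `n`
with nodes in the `I_i` (pairwise distinct for each `i`) are non-negative. Only the values of `f`
on the box matter. -/
def IsBoxConvexOn {d : ℕ} (I : Fin d → Set ℝ) (n : Fin d → ℕ) (f : (Fin d → ℝ) → ℝ) : Prop :=
  ∀ x : (i : Fin d) → Fin (n i + 1) → ℝ,
    (∀ i j, x i j ∈ I i) → (∀ i, Function.Injective (x i)) → 0 ≤ multiDividedDiff n x f

/-- `W` is, on the box `I₁ × ⋯ × I_d`, a pseudo-polynomial of degree `m ∈ {-1, 0, 1, …}^d`: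
`W(x) = ∑ᵢ ∑_{k=0}^{mᵢ} A_{ik}(x without its i-th coordinate) xᵢᵏ` with arbitrary functions
`A_{ik}`. -/
def IsPseudoPolynomialOn {d : ℕ} (I : Fin d → Set ℝ) (m : Fin d → ℤ) (W : (Fin d → ℝ) → ℝ) :
    Prop :=
  ∃ A : (i : Fin d) → ℕ → ({j : Fin d // j ≠ i} → ℝ) → ℝ, ∀ x ∈ box I,
    W x = ∑ i, ∑ k ∈ Finset.range (m i + 1).toNat, A i k (fun j => x j.1) * x i ^ k

/-- The set `I_{A,α}` of the `u` in the box with `u_j ≤ α_j` for `j ∈ A` and `u_j > α_j` for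
`j ∉ A`. -/
def orthant {d : ℕ} (I : Fin d → Set ℝ) (A : Finset (Fin d)) (α : Fin d → ℝ) :
    Set (Fin d → ℝ) :=
  {u | u ∈ box I ∧ (∀ j ∈ A, u j ≤ α j) ∧ ∀ j ∉ A, α j < u j}

/-- The spline kernel
`∏_{j ∉ A} (x_j - u_j)₊^{n_j - 1} / (n_j - 1)! · ∏_{j ∈ A} (-1)^{n_j} (x_j - u_j)₋^{n_j - 1} / (n_j - 1)!`
for orders `n_j ≥ 1`; `a⁺ = max a 0` and `a⁻ = max (-a) 0`. -/
noncomputable def splineKernel {d : ℕ} (n : Fin d → ℕ) (A : Finset (Fin d)) (x u : Fin d → ℝ) :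
    ℝ :=
  (∏ j ∈ Aᶜ, (x j - u j)⁺ ^ (n j - 1) / ((n j - 1).factorial : ℝ)) *
    ∏ j ∈ A, (-1) ^ n j * ((x j - u j)⁻ ^ (n j - 1) / ((n j - 1).factorial : ℝ))

end BoxConvexity

namespace BoxConvexity

/-- The pairing of a finitely supported weight with a function. -/
noncomputable abbrev pair (w : ℝ →₀ ℝ) (g : ℝ → ℝ) : ℝ := Finsupp.linearCombination ℝ g w

lemma pair_eq_sum {w : ℝ →₀ ℝ} {G : Finset ℝ} (h : w.support ⊆ G) (g : ℝ → ℝ) :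
    pair w g = ∑ s ∈ G, w s * g s := by
  rw [pair, Finsupp.linearCombination_apply, Finsupp.sum_of_support_subset w h _ (by simp)]
  rfl

lemma pair_congr {w : ℝ →₀ ℝ} {g h : ℝ → ℝ} (H : ∀ s ∈ w.support, g s = h s) :
    pair w g = pair w h := by
  rw [pair_eq_sum subset_rfl, pair_eq_sum subset_rfl]
  exact Finset.sum_congr rfl fun s hs => by rw [H s hs]

lemma pair_eq_zero {w : ℝ →₀ ℝ} {g : ℝ → ℝ} (H : ∀ s ∈ w.support, g s = 0) : pair w g = 0 := by
  rw [pair_eq_sum subset_rfl]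
  exact Finset.sum_eq_zero fun s hs => by rw [H s hs, mul_zero]

lemma pair_add (w : ℝ →₀ ℝ) (g h : ℝ → ℝ) :
    pair w (fun s => g s + h s) = pair w g + pair w h := by
  simp only [pair_eq_sum (subset_refl w.support), mul_add, Finset.sum_add_distrib]

lemma pair_sub (w : ℝ →₀ ℝ) (g h : ℝ → ℝ) :
    pair w (fun s => g s - h s) = pair w g - pair w h := by
  simp only [pair_eq_sum (subset_refl w.support), mul_sub, Finset.sum_sub_distrib]

lemma pair_mul_left (w : ℝ →₀ ℝ) (c : ℝ) (g : ℝ → ℝ) :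
    pair w (fun s => c * g s) = c * pair w g := by
  simp only [pair_eq_sum (subset_refl w.support), Finset.mul_sum]
  exact Finset.sum_congr rfl fun s _ => by ring

lemma pair_sum {κ : Type*} (w : ℝ →₀ ℝ) (S : Finset κ) (g : κ → ℝ → ℝ) :
    pair w (fun s => ∑ k ∈ S, g k s) = ∑ k ∈ S, pair w (g k) := by
  simp only [pair_eq_sum (subset_refl w.support), Finset.mul_sum]
  exact Finset.sum_comm

lemma ext_pair {w v : ℝ →₀ ℝ} (h : ∀ g, pair w g = pair v g) : w = v := by
  ext a
  have key : ∀ u : ℝ →₀ ℝ, pair u (Pi.single a 1) = u a := fun u => by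
    rw [pair_eq_sum (G := insert a u.support) (Finset.subset_insert _ _),
      Finset.sum_eq_single a (fun b _ hb => by simp [hb])
      (fun h => (h (Finset.mem_insert_self _ _)).elim)]
    simp
  rw [← key w, ← key v, h]

/-- The divided difference with node set `s`, as a weight. -/
noncomputable def dd (s : Finset ℝ) : ℝ →₀ ℝ :=
  ∑ a ∈ s, Finsupp.single a (∏ b ∈ s.erase a, (a - b)⁻¹)

lemma support_dd (s : Finset ℝ) : (dd s).support ⊆ s := by
  refine Finsupp.support_finsetSum.trans (Finset.biUnion_subset.2 fun a ha => ?_)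
  exact Finsupp.support_single_subset.trans (Finset.singleton_subset_iff.2 ha)

lemma pair_dd (s : Finset ℝ) (g : ℝ → ℝ) :
    pair (dd s) g = ∑ a ∈ s, (∏ b ∈ s.erase a, (a - b)⁻¹) * g a := by
  simp [pair, dd]

lemma pair_dd_singleton (a : ℝ) (g : ℝ → ℝ) : pair (dd {a}) g = g a := by
  simp [pair_dd]

lemma pair_dd_sub_mul {s : Finset ℝ} {a : ℝ} (ha : a ∈ s) (g : ℝ → ℝ) :
    pair (dd s) (fun t => (t - a) * g t) = pair (dd (s.erase a)) g := by
  rw [pair_dd, pair_dd, ← Finset.add_sum_erase s _ ha]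
  simp only [sub_self, zero_mul, mul_zero, zero_add]
  refine Finset.sum_congr rfl fun c hc => ?_
  have hca : c ≠ a := (Finset.mem_erase.1 hc).1
  have hac : a ∈ s.erase c := Finset.mem_erase.2 ⟨hca.symm, ha⟩
  rw [← Finset.mul_prod_erase _ _ hac, Finset.erase_right_comm]
  have : c - a ≠ 0 := sub_ne_zero.2 hca
  field_simp

lemma pair_dd_rec {s : Finset ℝ} {a b : ℝ} (ha : a ∈ s) (hb : b ∈ s) (g : ℝ → ℝ) :
    (b - a) * pair (dd s) g = pair (dd (s.erase a)) g - pair (dd (s.erase b)) g := by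
  rw [← pair_dd_sub_mul ha, ← pair_dd_sub_mul hb, ← pair_sub, ← pair_mul_left]
  congr 1
  funext t
  ring_nf

lemma pair_dd_const {s : Finset ℝ} (hs : 2 ≤ s.card) (c : ℝ) : pair (dd s) (fun _ => c) = 0 := by
  induction hk : s.card using Nat.strong_induction_on generalizing s with
  | _ k ih =>
    obtain ⟨a, ha, b, hb, hab⟩ := Finset.one_lt_card.1 (show 1 < s.card by omega)
    have h := pair_dd_rec ha hb fun _ => c
    have hne : b - a ≠ 0 := sub_ne_zero.2 hab.symm
    have e : ∀ x ∈ s, (s.erase x).card = k - 1 := fun x hx => by rw [Finset.card_erase_of_mem hx, hk]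
    rcases (show k = 2 ∨ 3 ≤ k by omega) with rfl | h3
    · obtain ⟨x, hx⟩ := Finset.card_eq_one.1 (e a ha)
      obtain ⟨y, hy⟩ := Finset.card_eq_one.1 (e b hb)
      rw [hx, hy, pair_dd_singleton, pair_dd_singleton, sub_self] at h
      exact (mul_eq_zero.1 h).resolve_left hne
    · rw [ih (k - 1) (by omega) (by rw [e a ha]; omega) (e a ha),
        ih (k - 1) (by omega) (by rw [e b hb]; omega) (e b hb), sub_self] at h
      exact (mul_eq_zero.1 h).resolve_left hne

lemma pair_dd_eval {s : Finset ℝ} {p : Polynomial ℝ} (hp : p.natDegree + 1 < s.card) :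
    pair (dd s) (fun t => p.eval t) = 0 := by
  induction hk : s.card generalizing s p with
  | zero => omega
  | succ k ih =>
    obtain ⟨a, ha⟩ := Finset.card_pos.1 (show 0 < s.card by omega)
    obtain ⟨q, hq⟩ := Polynomial.X_sub_C_dvd_sub_C_eval (a := a) (p := p)
    have hev : ∀ t, p.eval t = p.eval a + (t - a) * q.eval t := fun t => by
      have := congrArg (Polynomial.eval t) hq
      simp at this
      linarith
    rw [show (fun t => p.eval t) = fun t => p.eval a + (t - a) * q.eval t from funext hev,
      pair_add, pair_dd_const (by omega), pair_dd_sub_mul ha, zero_add]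
    have hc : (s.erase a).card = k := by rw [Finset.card_erase_of_mem ha]; omega
    by_cases hq0 : q = 0
    · subst hq0
      exact pair_eq_zero fun _ _ => by simp
    · refine ih ?_ hc
      have : (p - Polynomial.C (p.eval a)).natDegree = q.natDegree + 1 := by
        rw [hq, Polynomial.natDegree_mul (Polynomial.X_sub_C_ne_zero a) hq0,
          Polynomial.natDegree_X_sub_C, add_comm]
      rw [Polynomial.natDegree_sub_C] at this
      omega

lemma dividedDiff_eq_pair (n : ℕ) (x : Fin (n + 1) → ℝ) (hx : Function.Injective x) (f : ℝ → ℝ) :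
    dividedDiff n x f = pair (dd (Finset.univ.image x)) f := by
  induction n with
  | zero =>
    have : Finset.univ.image x = {x 0} := by ext; simp
    rw [this, pair_dd_singleton, dividedDiff]
  | succ n ih =>
    rw [dividedDiff, ih (fun j => x j.succ) (hx.comp (Fin.succ_injective _)),
      ih (fun j => x j.castSucc) (hx.comp (Fin.castSucc_injective _))]
    have h0 : (Finset.univ.image x).erase (x 0) = Finset.univ.image fun j : Fin (n + 1) => x j.succ := by
      ext c
      simp only [Finset.mem_erase, Finset.mem_image, Finset.mem_univ, true_and]
      constructor
      · rintro ⟨hc, j, rfl⟩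
        obtain ⟨i, rfl⟩ := Fin.exists_succ_eq (x := j).2 fun h => hc (by rw [h])
        exact ⟨i, rfl⟩
      · rintro ⟨i, rfl⟩
        exact ⟨fun h => Fin.succ_ne_zero i (hx h), _, rfl⟩
    have h1 : (Finset.univ.image x).erase (x (Fin.last _)) =
        Finset.univ.image fun j : Fin (n + 1) => x j.castSucc := by
      ext c
      simp only [Finset.mem_erase, Finset.mem_image, Finset.mem_univ, true_and]
      constructor
      · rintro ⟨hc, j, rfl⟩
        obtain ⟨i, rfl⟩ := Fin.exists_castSucc_eq (i := j).2 fun h => hc (by rw [h])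
        exact ⟨i, rfl⟩
      · rintro ⟨i, rfl⟩
        exact ⟨fun h => Fin.castSucc_ne_last i (hx h), _, rfl⟩
    have hne : x (Fin.last (n + 1)) - x 0 ≠ 0 :=
      sub_ne_zero.2 fun h => (Fin.last_pos).ne' (hx h)
    rw [div_eq_iff hne, ← h0, ← h1, ← pair_dd_rec (Finset.mem_image_of_mem _ (Finset.mem_univ _))
      (Finset.mem_image_of_mem _ (Finset.mem_univ _)), mul_comm]

/-- The truncated product `∏_{1 ≤ k < n} (s - τ k)`, cut off to the right of `τ 0`. -/
noncomputable def truncProd (τ : ℕ → ℝ) (n : ℕ) (s : ℝ) : ℝ :=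
  if τ 0 < s then ∏ k ∈ Finset.Ico 1 n, (s - τ k) else 0

lemma truncProd_succ (τ : ℕ → ℝ) {n : ℕ} (hn : 1 ≤ n) (s : ℝ) :
    truncProd τ (n + 1) s = (s - τ n) * truncProd τ n s := by
  unfold truncProd
  split_ifs
  · rw [Finset.prod_Ico_succ_top hn, mul_comm]
  · simp

lemma exists_polynomial_prod (τ : ℕ → ℝ) (n : ℕ) : ∃ p : Polynomial ℝ, p.natDegree = n - 1 ∧
    ∀ s, p.eval s = ∏ k ∈ Finset.Ico 1 n, (s - τ k) :=
  ⟨∏ k ∈ Finset.Ico 1 n, (Polynomial.X - Polynomial.C (τ k)), by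
    rw [Polynomial.natDegree_prod _ _ fun i _ => Polynomial.X_sub_C_ne_zero _]
    simp, fun s => by simp [Polynomial.eval_prod]⟩

lemma pair_dd_truncProd_nonneg {τ : ℕ → ℝ} (hτ : Monotone τ) {n : ℕ} (hn : 1 ≤ n) {z : Finset ℝ}
    (hz : z.card = n + 1)
    (hgap : ∀ s ∈ z, ∀ m, s < τ m → s ≤ τ 0 ∨ ∃ k ∈ Finset.Ico 1 m, s = τ k) :
    0 ≤ pair (dd z) (truncProd τ n) := by
  induction n, hn using Nat.le_induction generalizing z with
  | base =>
    obtain ⟨a, b, hab, rfl⟩ := Finset.card_eq_two.1 hz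
    wlog h : a < b generalizing a b
    · rw [Finset.pair_comm]
      refine this b a hab.symm (by rwa [Finset.pair_comm]) (by rwa [Finset.pair_comm]) ?_
      exact lt_of_le_of_ne (not_lt.1 h) hab.symm
    have hr := pair_dd_rec (s := {a, b}) (a := a) (b := b) (by simp) (by simp) (truncProd τ 1)
    rw [Finset.erase_insert (by simpa using hab), Finset.pair_comm,
      Finset.erase_insert (by simpa using hab.symm), Finset.pair_comm b a, pair_dd_singleton,
      pair_dd_singleton] at hr
    have hpos : 0 < b - a := sub_pos.2 h
    refine nonneg_of_mul_nonneg_right (a := b - a) ?_ hpos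
    rw [hr]
    simp only [truncProd, Finset.Ico_self, Finset.prod_empty]
    split_ifs with h1 h2 h2 <;> first | (exfalso; linarith) | norm_num
  | succ n hn ih =>
    have hzne : z.Nonempty := Finset.card_pos.1 (by omega)
    set a := z.min' hzne
    set b := z.max' hzne
    have ha : a ∈ z := z.min'_mem _
    have hb : b ∈ z := z.max'_mem _
    have hab : a < b := Finset.min'_lt_max'_of_card z (by omega)
    by_cases hca : τ n < a
    · refine le_of_eq ?_
      obtain ⟨p, hpd, hp⟩ := exists_polynomial_prod τ (n + 1)
      rw [← pair_dd_eval (s := z) (p := p) (by omega)]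
      refine pair_congr fun s hs => ?_
      rw [hp, truncProd, if_pos]
      exact ((hτ (Nat.zero_le n)).trans_lt hca).trans_le (z.min'_le s (support_dd z hs))
    by_cases hcb : b < τ n
    · refine le_of_eq (pair_eq_zero fun s hs => ?_).symm
      have hs := support_dd z hs
      have hsn : s < τ n := (z.le_max' s hs).trans_lt hcb
      unfold truncProd
      rcases hgap s hs n hsn with h | ⟨k, hk, rfl⟩
      · rw [if_neg h.not_gt]
      · rw [Finset.prod_eq_zero (i := k) (by simp at hk ⊢; omega) (sub_self _), ite_self]
    push Not at hca hcb
    have hf : truncProd τ (n + 1) = fun s => (s - τ n) * truncProd τ n s :=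
      funext fun s => truncProd_succ τ hn s
    have key : (b - a) * pair (dd z) (truncProd τ (n + 1)) =
        (b - τ n) * pair (dd (z.erase a)) (truncProd τ n) +
        (τ n - a) * pair (dd (z.erase b)) (truncProd τ n) := by
      rw [← pair_dd_sub_mul ha, ← pair_dd_sub_mul hb, ← pair_mul_left, ← pair_mul_left,
        ← pair_mul_left, ← pair_add, hf]
      congr 1
      funext s
      ring
    have h1 := ih (z := z.erase a) (by rw [Finset.card_erase_of_mem ha]; omega)
      fun s hs => hgap s (Finset.mem_of_mem_erase hs)
    have h2 := ih (z := z.erase b) (by rw [Finset.card_erase_of_mem hb]; omega)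
      fun s hs => hgap s (Finset.mem_of_mem_erase hs)
    refine nonneg_of_mul_nonneg_right (a := b - a) ?_ (sub_pos.2 hab)
    rw [key]
    exact add_nonneg (mul_nonneg (sub_nonneg.2 hcb) h1) (mul_nonneg (sub_nonneg.2 hca) h2)

lemma exists_strictMono_enum (G : Finset ℝ) :
    ∃ t : ℕ → ℝ, StrictMono t ∧ (Finset.range G.card).image t = G := by
  induction G using Finset.induction_on_max with
  | empty => exact ⟨fun j => j, Nat.strictMono_cast, by simp⟩
  | insert a G ha ih =>
    obtain ⟨t, ht, hG⟩ := ih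
    have hlt : ∀ j < G.card, t j < a := fun j hj =>
      ha _ (hG ▸ Finset.mem_image_of_mem t (Finset.mem_range.2 hj))
    have haG : a ∉ G := fun h => (ha a h).false
    refine ⟨fun j => if j < G.card then t j else a + ((j : ℝ) - G.card), ?_, ?_⟩
    · intro i j hij
      dsimp only
      split_ifs with h1 h2 h2
      · exact ht hij
      · have : (G.card : ℝ) ≤ j := by exact_mod_cast not_lt.1 h2
        linarith [hlt i h1]
      · omega
      · have : (i : ℝ) < j := by exact_mod_cast hij
        linarith
    · rw [Finset.card_insert_of_notMem haG, Finset.range_add_one, Finset.image_insert]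
      simp only [lt_irrefl, if_false, sub_self, add_zero]
      congr 1
      conv_rhs => rw [← hG]
      exact Finset.image_congr fun j hj => if_pos (Finset.mem_range.1 hj)

/-- The `n + 1` consecutive grid points `t j, …, t (j + n)`. -/
noncomputable def block (t : ℕ → ℝ) (j n : ℕ) : Finset ℝ := (Finset.range (n + 1)).image fun k => t (j + k)

lemma mem_block {t : ℕ → ℝ} {j n : ℕ} {s : ℝ} : s ∈ block t j n ↔ ∃ k ≤ n, t (j + k) = s := by
  simp [block]

lemma card_block {t : ℕ → ℝ} (ht : StrictMono t) (j n : ℕ) : (block t j n).card = n + 1 := by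
  rw [block, Finset.card_image_of_injective _ fun a b h => by
    have := ht.injective h; omega, Finset.card_range]

lemma block_erase_first {t : ℕ → ℝ} (ht : StrictMono t) (j n : ℕ) :
    (block t j (n + 1)).erase (t j) = block t (j + 1) n := by
  ext s
  simp only [Finset.mem_erase, mem_block]
  constructor
  · rintro ⟨hne, k, hk, rfl⟩
    have : k ≠ 0 := fun h => hne (by rw [h, add_zero])
    exact ⟨k - 1, by omega, by congr 1; omega⟩
  · rintro ⟨k, hk, rfl⟩
    exact ⟨(ht (by omega : j < j + 1 + k)).ne', k + 1, by omega, by congr 1; omega⟩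

lemma block_erase_last {t : ℕ → ℝ} (ht : StrictMono t) (j n : ℕ) :
    (block t j (n + 1)).erase (t (j + (n + 1))) = block t j n := by
  ext s
  simp only [Finset.mem_erase, mem_block]
  constructor
  · rintro ⟨hne, k, hk, rfl⟩
    have : k ≠ n + 1 := fun h => hne (by rw [h])
    exact ⟨k, by omega, rfl⟩
  · rintro ⟨k, hk, rfl⟩
    exact ⟨(ht (by omega : j + k < j + (n + 1))).ne, k, by omega, rfl⟩

lemma pair_dd_block_succ {t : ℕ → ℝ} (ht : StrictMono t) (j n : ℕ) (g : ℝ → ℝ) :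
    (t (j + (n + 1)) - t j) * pair (dd (block t j (n + 1))) g =
      pair (dd (block t (j + 1) n)) g - pair (dd (block t j n)) g := by
  rw [pair_dd_rec (mem_block.2 ⟨0, by omega, by rw [add_zero]⟩) (mem_block.2 ⟨n + 1, le_rfl, rfl⟩),
    block_erase_first ht, block_erase_last ht]

lemma block_zero (t : ℕ → ℝ) (j : ℕ) : block t j 0 = {t j} := by
  simp [block]

lemma sum_by_parts (h Q : ℕ → ℝ) (m : ℕ) :
    ∑ j ∈ Finset.range m, h j * (Q j - Q (j + 1)) =
      h 0 * Q 0 - h m * Q m + ∑ j ∈ Finset.range m, (h (j + 1) - h j) * Q (j + 1) := by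
  induction m with
  | zero => simp
  | succ m ih => rw [Finset.sum_range_succ, Finset.sum_range_succ, ih]; ring

/-- The discrete analogue of `s ↦ (s - t j)₊ ^ (n - 1)`. -/
noncomputable abbrev gridKernel (t : ℕ → ℝ) (n j : ℕ) : ℝ → ℝ := truncProd (fun k => t (j + k)) n

lemma gridKernel_eq_zero {t : ℕ → ℝ} (ht : StrictMono t) {n j m : ℕ} (h : m < j + n) :
    gridKernel t n j (t m) = 0 := by
  unfold gridKernel truncProd
  split_ifs with h1
  · have hm : j < m := ht.lt_iff_lt.1 h1
    refine Finset.prod_eq_zero (i := m - j) (by simp; omega) ?_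
    change t m - t (j + (m - j)) = 0
    rw [show j + (m - j) = m by omega, sub_self]
  · rfl

lemma gridKernel_of_lt {t : ℕ → ℝ} (ht : StrictMono t) {n j m : ℕ} (h : j < m) :
    gridKernel t n j (t m) = ∏ k ∈ Finset.Ico 1 n, (t m - t (j + k)) :=
  if_pos (ht h)

/-- Taylor's formula with remainder on a discrete grid. -/
lemma exists_grid_expansion {t : ℕ → ℝ} (ht : StrictMono t) {n : ℕ} (hn : 1 ≤ n) (g : ℝ → ℝ) :
    ∃ p : Polynomial ℝ, p.natDegree < n ∧ ∀ m, g (t m) = p.eval (t m) +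
      ∑ j ∈ Finset.range m,
        (t (j + n) - t j) * pair (dd (block t j n)) g * gridKernel t n j (t m) := by
  induction n, hn using Nat.le_induction with
  | base =>
    refine ⟨Polynomial.C (g (t 0)), by simp, fun m => ?_⟩
    have : ∀ j ∈ Finset.range m, (t (j + 1) - t j) * pair (dd (block t j 1)) g *
        gridKernel t 1 j (t m) = g (t (j + 1)) - g (t j) := fun j hj => by
      rw [gridKernel_of_lt ht (Finset.mem_range.1 hj), Finset.Ico_self, Finset.prod_empty, mul_one,
        pair_dd_block_succ ht, block_zero, block_zero, pair_dd_singleton, pair_dd_singleton]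
    rw [Finset.sum_congr rfl this, Finset.sum_range_sub (fun j => g (t j))]
    simp
  | succ n hn ih =>
    obtain ⟨p, hpd, hp⟩ := ih
    set h : ℕ → ℝ := fun j => pair (dd (block t j n)) g with hh
    refine ⟨p + Polynomial.C (h 0) * ∏ k ∈ Finset.range n, (Polynomial.X - Polynomial.C (t k)),
      ?_, fun m => ?_⟩
    · refine (Polynomial.natDegree_add_le _ _).trans_lt (max_lt (by omega) ?_)
      refine (Polynomial.natDegree_C_mul_le _ _).trans_lt ?_
      rw [Polynomial.natDegree_prod _ _ fun i _ => Polynomial.X_sub_C_ne_zero _]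
      simp
    · set Q : ℕ → ℝ := fun j => ∏ k ∈ Finset.range n, (t m - t (j + k)) with hQ
      have hQm : Q m = 0 := Finset.prod_eq_zero (i := 0) (by simp; omega) (by simp)
      have hQs : ∀ j, Q (j + 1) = ∏ k ∈ Finset.Ico 1 (n + 1), (t m - t (j + k)) := fun j => by
        rw [Finset.prod_Ico_eq_prod_range]
        simp only [hQ, Nat.add_sub_cancel]
        exact Finset.prod_congr rfl fun k _ => by congr 2; omega
      have hQ0 : ∀ j, Q j = (t m - t j) * ∏ k ∈ Finset.Ico 1 n, (t m - t (j + k)) := fun j => by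
        simp only [hQ]
        rw [Finset.range_eq_Ico, Finset.prod_eq_prod_Ico_succ_bot (by omega)]
        simp
      have e1 : ∀ j ∈ Finset.range m, (t (j + n) - t j) * pair (dd (block t j n)) g *
          gridKernel t n j (t m) = h j * (Q j - Q (j + 1)) := fun j hj => by
        rw [gridKernel_of_lt ht (Finset.mem_range.1 hj), hQs, hQ0, Finset.prod_Ico_succ_top hn]
        simp only [hh]
        ring
      have e2 : ∀ j ∈ Finset.range m, (t (j + (n + 1)) - t j) * pair (dd (block t j (n + 1))) g *
          gridKernel t (n + 1) j (t m) = (h (j + 1) - h j) * Q (j + 1) := fun j hj => by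
        rw [gridKernel_of_lt ht (Finset.mem_range.1 hj), hQs, pair_dd_block_succ ht]
      rw [hp m, Finset.sum_congr rfl e1, Finset.sum_congr rfl e2, sum_by_parts, hQm]
      simp [Polynomial.eval_prod, hQ]
      ring

/-- `w` annihilates the polynomials of degree less than `n`. -/
def KillsPoly (n : ℕ) (w : ℝ →₀ ℝ) : Prop :=
  ∀ p : Polynomial ℝ, p.natDegree < n → pair w (fun s => p.eval s) = 0

lemma killsPoly_dd {n : ℕ} {z : Finset ℝ} (hz : z.card = n + 1) : KillsPoly n (dd z) :=
  fun _ hp => pair_dd_eval (by omega)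

/-- The difference functional of order `n` at `t j`, normalised to be `1` on `gridKernel t n j`. -/
noncomputable def gridDiff (t : ℕ → ℝ) (n j : ℕ) : ℝ →₀ ℝ :=
  (t (j + n) - t j) • dd (block t j n)

lemma eq_sum_gridDiff {t : ℕ → ℝ} (ht : StrictMono t) {n : ℕ} (hn : 1 ≤ n) {w : ℝ →₀ ℝ}
    (hw : KillsPoly n w) {N : ℕ} (hN : w.support ⊆ (Finset.range N).image t) :
    w = ∑ j ∈ Finset.range (N - n), pair w (gridKernel t n j) • gridDiff t n j := by
  refine ext_pair fun g => ?_
  obtain ⟨p, hpd, hp⟩ := exists_grid_expansion ht hn g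
  have h1 : pair w g = pair w fun s => p.eval s + ∑ j ∈ Finset.range (N - n),
      pair (gridDiff t n j) g * gridKernel t n j s := by
    refine pair_congr fun s hs => ?_
    obtain ⟨m, hm, rfl⟩ := Finset.mem_image.1 (hN hs)
    have hm := Finset.mem_range.1 hm
    rw [hp m]
    congr 1
    have hz : ∀ j, m < j + n → pair (gridDiff t n j) g * gridKernel t n j (t m) = 0 :=
      fun j hj => by rw [gridKernel_eq_zero ht hj, mul_zero]
    have hpg : ∀ j, pair (gridDiff t n j) g = (t (j + n) - t j) * pair (dd (block t j n)) g :=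
      fun j => by simp [pair, gridDiff]
    simp only [← hpg]
    rw [Finset.sum_subset (s₂ := Finset.range (m + N)) (by simp) fun j _ hj => hz j (by
        simp at hj; omega),
      Finset.sum_subset (s₁ := Finset.range (N - n)) (s₂ := Finset.range (m + N)) (by simp; omega)
        fun j _ hj => hz j (by simp at hj; omega)]
  rw [h1, pair_add, hw p hpd, zero_add, pair_sum]
  simp only [pair_mul_left, pair, map_sum, map_smul, smul_eq_mul]
  exact Finset.sum_congr rfl fun j _ => mul_comm _ _

lemma pair_dd_gridKernel_nonneg {t : ℕ → ℝ} (ht : StrictMono t) {n : ℕ} (hn : 1 ≤ n) {z : Finset ℝ}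
    (hz : z.card = n + 1) {N : ℕ} (hzt : z ⊆ (Finset.range N).image t) (j : ℕ) :
    0 ≤ pair (dd z) (gridKernel t n j) := by
  refine pair_dd_truncProd_nonneg (fun a b h => ht.monotone (by omega)) hn hz fun s hs m hsm => ?_
  obtain ⟨i, -, rfl⟩ := Finset.mem_image.1 (hzt hs)
  have him : i < j + m := ht.lt_iff_lt.1 hsm
  rcases le_or_gt i j with h | h
  · exact Or.inl (ht.monotone (by omega))
  · exact Or.inr ⟨i - j, by simp; omega, by congr 1; omega⟩

/-- The tensor product of the weights `w i`, applied to `f`. -/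
noncomputable def multiEval {d : ℕ} (w : Fin d → ℝ →₀ ℝ) (f : (Fin d → ℝ) → ℝ) : ℝ :=
  ∑ s ∈ Fintype.piFinset fun i => (w i).support, (∏ i, w i (s i)) * f s

section multiEval

variable {d : ℕ} {w : Fin d → ℝ →₀ ℝ}

lemma multiEval_eq_sum {G : Fin d → Finset ℝ} (h : ∀ i, (w i).support ⊆ G i)
    (f : (Fin d → ℝ) → ℝ) :
    multiEval w f = ∑ s ∈ Fintype.piFinset G, (∏ i, w i (s i)) * f s := by
  refine Finset.sum_subset (Fintype.piFinset_subset _ _ h) fun s _ hs => ?_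
  simp only [Fintype.mem_piFinset, not_forall, Finsupp.notMem_support_iff] at hs
  obtain ⟨i, hi⟩ := hs
  rw [Finset.prod_eq_zero (Finset.mem_univ i) hi, zero_mul]

lemma multiEval_congr {f g : (Fin d → ℝ) → ℝ}
    (h : ∀ s, (∀ i, s i ∈ (w i).support) → f s = g s) : multiEval w f = multiEval w g :=
  Finset.sum_congr rfl fun s hs => by rw [h s (Fintype.mem_piFinset.1 hs)]

lemma multiEval_add (f g : (Fin d → ℝ) → ℝ) :
    multiEval w (fun s => f s + g s) = multiEval w f + multiEval w g := by
  simp only [multiEval, mul_add, Finset.sum_add_distrib]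

lemma multiEval_sub (f g : (Fin d → ℝ) → ℝ) :
    multiEval w (fun s => f s - g s) = multiEval w f - multiEval w g := by
  simp only [multiEval, mul_sub, Finset.sum_sub_distrib]

lemma multiEval_mul_left (c : ℝ) (f : (Fin d → ℝ) → ℝ) :
    multiEval w (fun s => c * f s) = c * multiEval w f := by
  simp only [multiEval, Finset.mul_sum, mul_left_comm]

lemma multiEval_sum {κ : Type*} (S : Finset κ) (f : κ → (Fin d → ℝ) → ℝ) :
    multiEval w (fun s => ∑ k ∈ S, f k s) = ∑ k ∈ S, multiEval w (f k) := by
  simp only [multiEval, Finset.mul_sum]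
  exact Finset.sum_comm

lemma multiEval_prod (g : Fin d → ℝ → ℝ) :
    multiEval w (fun s => ∏ i, g i (s i)) = ∏ i, pair (w i) (g i) := by
  simp only [pair_eq_sum (subset_refl _), Finset.prod_univ_sum, multiEval, Finset.prod_mul_distrib]

lemma multiEval_integral {X : Type*} [MeasurableSpace X] (μ : Measure X)
    (F : (Fin d → ℝ) → X → ℝ) (hF : ∀ s, (∀ i, s i ∈ (w i).support) → Integrable (F s) μ) :
    multiEval w (fun s => ∫ u, F s u ∂μ) = ∫ u, multiEval w (fun s => F s u) ∂μ := by
  simp only [multiEval]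
  rw [integral_finsetSum _ fun s hs => (hF s (Fintype.mem_piFinset.1 hs)).const_mul _]
  simp only [integral_const_mul]

lemma multiEval_single (x : Fin d → ℝ) (f : (Fin d → ℝ) → ℝ) :
    multiEval (fun i => Finsupp.single (x i) 1) f = f x := by
  rw [multiEval_eq_sum (G := fun i => {x i}) fun i => Finsupp.support_single_subset,
    Fintype.piFinset_singleton]
  simp

lemma multiEval_sum_smul {κ : Fin d → Type*} (S : (i : Fin d) → Finset (κ i))
    (c : (i : Fin d) → κ i → ℝ) (v : (i : Fin d) → κ i → ℝ →₀ ℝ)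
    (hw : ∀ i, w i = ∑ j ∈ S i, c i j • v i j) (f : (Fin d → ℝ) → ℝ) :
    multiEval w f = ∑ J ∈ Fintype.piFinset S,
      (∏ i, c i (J i)) * multiEval (fun i => v i (J i)) f := by
  classical
  set G : Fin d → Finset ℝ := fun i => (w i).support ∪ (S i).biUnion fun j => (v i j).support
    with hG
  have h1 : ∀ J ∈ Fintype.piFinset S, (∏ i, c i (J i)) * multiEval (fun i => v i (J i)) f =
      ∑ s ∈ Fintype.piFinset G, (∏ i, c i (J i) * v i (J i) (s i)) * f s := fun J hJ => by
    rw [multiEval_eq_sum (G := G) fun i => (Finset.subset_biUnion_of_mem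
      (fun j => (v i j).support) (Fintype.mem_piFinset.1 hJ i)).trans Finset.subset_union_right,
      Finset.mul_sum]
    exact Finset.sum_congr rfl fun s _ => by rw [Finset.prod_mul_distrib, mul_assoc]
  rw [Finset.sum_congr rfl h1, Finset.sum_comm,
    multiEval_eq_sum (G := G) fun i => Finset.subset_union_left]
  refine Finset.sum_congr rfl fun s _ => ?_
  rw [← Finset.sum_mul, ← Finset.prod_univ_sum S fun i j => c i j * v i j (s i)]
  congr 1
  refine Finset.prod_congr rfl fun i _ => ?_
  rw [hw i]
  simp [Finsupp.finsetSum_apply]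

lemma prod_update_apply (u : Fin d → ℝ →₀ ℝ) (i : Fin d) (y : ℝ →₀ ℝ) (s : Fin d → ℝ) :
    ∏ j, Function.update u i y j (s j) = y (s i) * ∏ j ∈ Finset.univ.erase i, u j (s j) := by
  rw [← Finset.mul_prod_erase _ _ (Finset.mem_univ i), Function.update_self]
  congr 1
  exact Finset.prod_congr rfl fun j hj => by
    rw [Function.update_of_ne (Finset.ne_of_mem_erase hj)]

lemma multiEval_update_sum {κ : Type*} (u : Fin d → ℝ →₀ ℝ) (i : Fin d) (S : Finset κ) (c : κ → ℝ)
    (v : κ → ℝ →₀ ℝ) (f : (Fin d → ℝ) → ℝ) :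
    multiEval (Function.update u i (∑ k ∈ S, c k • v k)) f =
      ∑ k ∈ S, c k * multiEval (Function.update u i (v k)) f := by
  classical
  set H : Finset ℝ := (∑ k ∈ S, c k • v k).support ∪ S.biUnion fun k => (v k).support
  set G : Fin d → Finset ℝ := Function.update (fun j => (u j).support) i H with hG
  have hsub : ∀ y : ℝ →₀ ℝ, y.support ⊆ H → ∀ j, (Function.update u i y j).support ⊆ G j := by
    intro y hy j
    rcases eq_or_ne j i with rfl | h
    · simpa [hG] using hy
    · simp [hG, h]
  have h1 : ∀ k ∈ S, c k * multiEval (Function.update u i (v k)) f =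
      ∑ s ∈ Fintype.piFinset G,
        c k * v k (s i) * ((∏ j ∈ Finset.univ.erase i, u j (s j)) * f s) := fun k hk => by
    rw [multiEval_eq_sum (hsub (v k) ((Finset.subset_biUnion_of_mem
      (fun j => (v j).support) hk).trans Finset.subset_union_right)), Finset.mul_sum]
    exact Finset.sum_congr rfl fun s _ => by rw [prod_update_apply]; ring
  rw [Finset.sum_congr rfl h1, Finset.sum_comm,
    multiEval_eq_sum (hsub _ Finset.subset_union_left)]
  refine Finset.sum_congr rfl fun s _ => ?_
  rw [← Finset.sum_mul, prod_update_apply, Finsupp.finsetSum_apply]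
  simp only [Finsupp.smul_apply, smul_eq_mul, mul_assoc]

lemma multiEval_update_single_congr (u : Fin d → ℝ →₀ ℝ) (i : Fin d) (a b : ℝ)
    {f : (Fin d → ℝ) → ℝ} (hf : ∀ s t, (∀ j ≠ i, s j = t j) → f s = f t) :
    multiEval (Function.update u i (Finsupp.single a 1)) f =
      multiEval (Function.update u i (Finsupp.single b 1)) f := by
  have hmem : ∀ (a b : ℝ), ∀ s ∈ Fintype.piFinset fun j =>
      (Function.update u i (Finsupp.single a 1) j).support, Function.update s i b ∈
      Fintype.piFinset fun j => (Function.update u i (Finsupp.single b 1) j).support := by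
    intro a b s hs
    rw [Fintype.mem_piFinset] at hs ⊢
    intro j
    rcases eq_or_ne j i with rfl | h
    · simp
    · simpa [h] using hs j
  have hsi : ∀ (a : ℝ), ∀ s ∈ Fintype.piFinset fun j =>
      (Function.update u i (Finsupp.single a 1) j).support, s i = a := by
    intro a s hs
    have := Fintype.mem_piFinset.1 hs i
    rw [Function.update_self] at this
    exact Finset.mem_singleton.1 (Finsupp.support_single_subset this)
  refine Finset.sum_nbij' (fun s => Function.update s i b) (fun s => Function.update s i a)
    (hmem a b) (hmem b a) ?_ ?_ ?_
  · intro s hs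
    rw [Function.update_idem, ← hsi a s hs, Function.update_eq_self]
  · intro s hs
    rw [Function.update_idem, ← hsi b s hs, Function.update_eq_self]
  · intro s hs
    rw [prod_update_apply, prod_update_apply, hsi a s hs, Function.update_self,
      Finsupp.single_eq_same, Finsupp.single_eq_same,
      hf s (Function.update s i b) fun j hj => by rw [Function.update_of_ne hj]]
    congr 2
    exact Finset.prod_congr rfl fun j hj => by
      rw [Function.update_of_ne (Finset.ne_of_mem_erase hj)]

lemma multiEval_eq_zero_of_pseudoPolynomial {I : Fin d → Set ℝ} {n : Fin d → ℕ}
    (hI : ∀ i, ∀ s ∈ (w i).support, s ∈ I i) (hw : ∀ i, KillsPoly (n i) (w i))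
    {W : (Fin d → ℝ) → ℝ} (hW : IsPseudoPolynomialOn I (fun i => (n i : ℤ) - 1) W) :
    multiEval w W = 0 := by
  obtain ⟨A, hA⟩ := hW
  rw [multiEval_congr fun s hs => hA s fun i => hI i _ (hs i), multiEval_sum]
  refine Finset.sum_eq_zero fun i _ => ?_
  rw [multiEval_sum]
  refine Finset.sum_eq_zero fun k hk => ?_
  have hk : k < n i := by simp at hk; omega
  have hwi : w i = ∑ a ∈ (w i).support, w i a • Finsupp.single a 1 := by
    conv_lhs => rw [← Finsupp.sum_single (w i), Finsupp.sum]
    simp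
  rw [← Function.update_eq_self i w, hwi, multiEval_update_sum]
  have h1 : ∀ a ∈ (w i).support, w i a * multiEval (Function.update w i (Finsupp.single a 1))
      (fun s => A i k (fun j => s j.1) * s i ^ k) = w i a * a ^ k *
      multiEval (Function.update w i (Finsupp.single 0 1)) (fun s => A i k (fun j => s j.1)) := by
    intro a _
    rw [multiEval_update_single_congr w i 0 a, mul_assoc, ← multiEval_mul_left (a ^ k)]
    · refine congrArg (w i a * ·) ?_
      refine multiEval_congr fun s hs => ?_
      have := hs i
      rw [Function.update_self] at this
      rw [Finset.mem_singleton.1 (Finsupp.support_single_subset this), mul_comm]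
    · intro s t h
      congr 1
      funext j
      exact h _ j.2
  rw [Finset.sum_congr rfl h1, ← Finset.sum_mul]
  have := hw i (Polynomial.X ^ k) (by simpa using hk)
  rw [pair_eq_sum subset_rfl] at this
  simp only [Polynomial.eval_pow, Polynomial.eval_X] at this
  rw [this, zero_mul]

end multiEval

lemma multiDividedDiff_eq_multiEval {d : ℕ} (n : Fin d → ℕ) (x : (i : Fin d) → Fin (n i + 1) → ℝ)
    (hx : ∀ i, Function.Injective (x i)) (f : (Fin d → ℝ) → ℝ) :
    multiDividedDiff n x f = multiEval (fun i => dd (Finset.univ.image (x i))) f := by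
  induction d with
  | zero =>
    simp only [multiDividedDiff, multiEval, Finset.univ_eq_empty, Finset.prod_empty, one_mul]
    rw [Finset.sum_congr rfl (g := fun _ => f Fin.elim0) fun s _ => by
      congr 1; exact Subsingleton.elim _ _]
    simp
  | succ d ih =>
    rw [multiDividedDiff, dividedDiff_eq_pair _ _ (hx _)]
    simp only [ih _ _ fun i : Fin d => hx i.castSucc]
    rw [pair_eq_sum subset_rfl]
    simp only [multiEval, Finset.mul_sum]
    rw [← Finset.sum_product']
    refine Finset.sum_nbij' (fun p => Fin.snoc (α := fun _ => ℝ) p.2 p.1)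
      (fun s => (s (Fin.last d), fun i => s i.castSucc)) ?_ ?_ ?_ ?_ ?_
    · intro p hp
      rw [Finset.mem_product, Fintype.mem_piFinset] at hp
      rw [Fintype.mem_piFinset]
      intro i
      refine Fin.lastCases ?_ (fun j => ?_) i
      · simpa using hp.1
      · simpa using hp.2 j
    · intro s hs
      rw [Fintype.mem_piFinset] at hs
      exact Finset.mem_product.2 ⟨hs _, Fintype.mem_piFinset.2 fun i => hs _⟩
    · intro p _
      simp
    · intro s _
      exact Fin.snoc_init_self s
    · intro p _
      simp only [Fin.prod_univ_castSucc, Fin.snoc_castSucc, Fin.snoc_last]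
      ring

section interpolation

/-- The weight of Lagrange interpolation at the nodes `Y`, evaluated at `x`. -/
noncomputable def lagrangeWeight (Y : Finset ℝ) (x : ℝ) : ℝ →₀ ℝ :=
  ∑ a ∈ Y, (Lagrange.basis Y id a).eval x • Finsupp.single a 1

/-- The weight of the error of Lagrange interpolation at the nodes `Y`, evaluated at `x`. -/
noncomputable def remainderWeight (Y : Finset ℝ) (x : ℝ) : ℝ →₀ ℝ :=
  Finsupp.single x 1 - lagrangeWeight Y x

lemma support_lagrangeWeight (Y : Finset ℝ) (x : ℝ) : (lagrangeWeight Y x).support ⊆ Y := by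
  refine Finsupp.support_finsetSum.trans (Finset.biUnion_subset.2 fun a ha => ?_)
  exact Finsupp.support_smul.trans
    (Finsupp.support_single_subset.trans (Finset.singleton_subset_iff.2 ha))

lemma support_remainderWeight (Y : Finset ℝ) (x : ℝ) :
    (remainderWeight Y x).support ⊆ insert x Y := by
  refine Finsupp.support_sub.trans (Finset.union_subset ?_ ?_)
  · exact Finsupp.support_single_subset.trans (by simp)
  · exact (support_lagrangeWeight Y x).trans (Finset.subset_insert _ _)

lemma pair_remainderWeight (Y : Finset ℝ) (x : ℝ) (g : ℝ → ℝ) :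
    pair (remainderWeight Y x) g = g x - ∑ a ∈ Y, (Lagrange.basis Y id a).eval x * g a := by
  simp [pair, remainderWeight, lagrangeWeight]

lemma killsPoly_remainderWeight (Y : Finset ℝ) (x : ℝ) :
    KillsPoly Y.card (remainderWeight Y x) := by
  intro p hp
  rw [pair_remainderWeight, sub_eq_zero]
  have h := Lagrange.eq_interpolate (s := Y) (v := id) (f := p) Function.injective_id.injOn
    (lt_of_le_of_lt Polynomial.degree_le_natDegree (by exact_mod_cast hp))
  conv_lhs => rw [h]
  simp [Lagrange.interpolate_apply, Polynomial.eval_finsetSum, mul_comm]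

lemma isPseudoPolynomialOn_of_multiEval_remainderWeight {d : ℕ} {I : Fin d → Set ℝ} {n : Fin d → ℕ}
    (hn : ∀ i, 1 ≤ n i) {Y : Fin d → Finset ℝ} (hY : ∀ i, (Y i).card = n i)
    {g : (Fin d → ℝ) → ℝ}
    (hg : ∀ x ∈ box I, multiEval (fun i => remainderWeight (Y i) (x i)) g = 0) :
    IsPseudoPolynomialOn I (fun i => (n i : ℤ) - 1) g := by
  classical
  let u : (i : Fin d) → ({j : Fin d // j ≠ i} → ℝ) → Fin d → ℝ →₀ ℝ := fun i x j =>
    if h : j ≠ i then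
      (if j < i then remainderWeight (Y j) (x ⟨j, h⟩) else Finsupp.single (x ⟨j, h⟩) 1)
    else 0
  refine ⟨fun i k x => ∑ a ∈ Y i, (Lagrange.basis (Y i) id a).coeff k *
    multiEval (Function.update (u i x) i (Finsupp.single a 1)) g, fun x hx => ?_⟩
  set G : Fin d → Finset ℝ := fun i => insert (x i) (Y i) with hG
  have key : multiEval (fun i => remainderWeight (Y i) (x i)) g = g x - ∑ i, multiEval
      (Function.update (u i fun j => x j.1) i (lagrangeWeight (Y i) (x i))) g := by
    have hv : ∀ i j, (Function.update (u i fun j => x j.1) i (lagrangeWeight (Y i) (x i)) j).support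
        ⊆ G j := by
      intro i j
      rcases eq_or_ne j i with rfl | h
      · rw [Function.update_self]
        exact (support_lagrangeWeight _ _).trans (Finset.subset_insert _ _)
      · rw [Function.update_of_ne h]
        simp only [u, dif_pos h]
        split_ifs
        · exact support_remainderWeight _ _
        · exact Finsupp.support_single_subset.trans (by simp [hG])
    rw [← multiEval_single x g, multiEval_eq_sum (G := G) fun i => support_remainderWeight _ _,
      multiEval_eq_sum (G := G) fun i => Finsupp.support_single_subset.trans (by simp [hG]),
      Finset.sum_congr rfl fun i _ => multiEval_eq_sum (hv i) g, Finset.sum_comm,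
      ← Finset.sum_sub_distrib]
    refine Finset.sum_congr rfl fun s _ => ?_
    rw [← Finset.sum_mul, ← sub_mul]
    congr 1
    simp only [remainderWeight, Finsupp.sub_apply]
    rw [Finset.prod_sub_ordered]
    congr 1
    refine Finset.sum_congr rfl fun i _ => ?_
    rw [prod_update_apply, mul_assoc]
    congr 1
    rw [← Finset.prod_filter_mul_prod_filter_not (Finset.univ.erase i) (fun j => j < i)]
    congr 1
    · refine Finset.prod_congr ?_ fun j hj => ?_
      · ext j; simp; exact fun h => h.ne
      · have hj := (Finset.mem_filter.1 hj).2
        simp [u, hj.ne, hj, remainderWeight]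
    · refine Finset.prod_congr ?_ fun j hj => ?_
      · ext j; simp; exact ⟨fun h => ⟨h.ne', h.le⟩, fun h => lt_of_le_of_ne h.2 (Ne.symm h.1)⟩
      · obtain ⟨hj1, hj2⟩ := Finset.mem_filter.1 hj
        simp [u, Finset.ne_of_mem_erase hj1, hj2]
  rw [hg x hx, eq_comm, sub_eq_zero] at key
  rw [key]
  refine Finset.sum_congr rfl fun i _ => ?_
  rw [lagrangeWeight, multiEval_update_sum]
  simp only [Finset.sum_mul]
  rw [Finset.sum_comm]
  refine Finset.sum_congr rfl fun a ha => ?_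
  have hdeg : (Lagrange.basis (Y i) id a).natDegree < ((n i : ℤ) - 1 + 1).toNat := by
    rw [Polynomial.natDegree_eq_of_degree_eq_some
      (Lagrange.degree_basis Function.injective_id.injOn ha), hY]
    have := hn i
    omega
  rw [Polynomial.eval_eq_sum_range' hdeg, Finset.sum_mul]
  exact Finset.sum_congr rfl fun k _ => by ring

end interpolation

lemma abs_prod_sub_prod_le {κ : Type*} (S : Finset κ) {x y : κ → ℝ} {B η : ℝ} (hB : 1 ≤ B)
    (hη : 0 ≤ η) (hx : ∀ k ∈ S, |x k| ≤ B) (hy : ∀ k ∈ S, |y k| ≤ B)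
    (hxy : ∀ k ∈ S, |x k - y k| ≤ η) :
    |∏ k ∈ S, x k - ∏ k ∈ S, y k| ≤ S.card * η * B ^ S.card := by
  classical
  induction S using Finset.induction_on with
  | empty => simp
  | insert a S ha ih =>
    have h1 := ih (fun k hk => hx k (Finset.mem_insert_of_mem hk))
      (fun k hk => hy k (Finset.mem_insert_of_mem hk))
      fun k hk => hxy k (Finset.mem_insert_of_mem hk)
    have h2 : |∏ k ∈ S, y k| ≤ B ^ S.card := by
      rw [Finset.abs_prod]
      exact (Finset.prod_le_prod (fun _ _ => abs_nonneg _)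
        fun k hk => hy k (Finset.mem_insert_of_mem hk)).trans_eq (Finset.prod_const _)
    rw [Finset.prod_insert ha, Finset.prod_insert ha, Finset.card_insert_of_notMem ha]
    have h3 : x a * ∏ k ∈ S, x k - y a * ∏ k ∈ S, y k =
        x a * (∏ k ∈ S, x k - ∏ k ∈ S, y k) + (x a - y a) * ∏ k ∈ S, y k := by ring
    have hpos : 0 ≤ B ^ S.card := by positivity
    calc _ ≤ |x a| * |∏ k ∈ S, x k - ∏ k ∈ S, y k| + |x a - y a| * |∏ k ∈ S, y k| := by
          rw [h3, ← abs_mul, ← abs_mul]; exact abs_add_le _ _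
      _ ≤ B * (S.card * η * B ^ S.card) + η * B ^ S.card := by
          gcongr
          · exact hx a (Finset.mem_insert_self _ _)
          · exact hxy a (Finset.mem_insert_self _ _)
      _ ≤ B * (S.card * η * B ^ S.card) + η * (B * B ^ S.card) := by
          gcongr
          exact le_mul_of_one_le_left hpos hB
      _ = _ := by push_cast; ring

/-- The truncated power `(s - u)₊ ^ (n - 1) / (n - 1)!`. -/
noncomputable def truncPow (n : ℕ) (u s : ℝ) : ℝ := (s - u)⁺ ^ (n - 1) / ((n - 1).factorial : ℝ)

lemma truncPow_of_le {n : ℕ} (hn : 2 ≤ n) {u s : ℝ} (h : s ≤ u) : truncPow n u s = 0 := by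
  rw [truncPow, posPart_eq_zero.2 (sub_nonpos.2 h), zero_pow (by omega), zero_div]

lemma truncPow_of_ge {n : ℕ} {u s : ℝ} (h : u ≤ s) :
    truncPow n u s = (s - u) ^ (n - 1) / ((n - 1).factorial : ℝ) := by
  rw [truncPow, posPart_eq_self.2 (sub_nonneg.2 h)]

lemma continuous_truncPow (n : ℕ) (s : ℝ) : Continuous fun u => truncPow n u s := by
  unfold truncPow
  simp only [posPart_def]
  fun_prop

lemma truncPow_eq_truncProd {n : ℕ} (hn : 2 ≤ n) (u s : ℝ) :
    truncPow n u s = ((n - 1).factorial : ℝ)⁻¹ * truncProd (fun _ => u) n s := by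
  rcases le_or_gt s u with h | h
  · rw [truncPow_of_le hn h, truncProd, if_neg h.not_gt, mul_zero]
  · rw [truncPow_of_ge h.le, truncProd, if_pos h]
    simp [div_eq_inv_mul]

lemma pair_dd_truncPow_nonneg {n : ℕ} (hn : 2 ≤ n) {z : Finset ℝ} (hz : z.card = n + 1) (u : ℝ) :
    0 ≤ pair (dd z) (truncPow n u) := by
  rw [show truncPow n u = fun s => ((n - 1).factorial : ℝ)⁻¹ * truncProd (fun _ => u) n s from
    funext fun s => truncPow_eq_truncProd hn u s, pair_mul_left]
  exact mul_nonneg (by positivity)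
    (pair_dd_truncProd_nonneg monotone_const (by omega) hz fun s _ m h => Or.inl h.le)

lemma exists_polynomial_sub_pow (n : ℕ) (hn : 1 ≤ n) (u : ℝ) : ∃ p : Polynomial ℝ, p.natDegree < n ∧
    ∀ s, p.eval s = (s - u) ^ (n - 1) / ((n - 1).factorial : ℝ) := by
  refine ⟨Polynomial.C ((n - 1).factorial : ℝ)⁻¹ * (Polynomial.X - Polynomial.C u) ^ (n - 1), ?_,
    fun s => by simp [div_eq_inv_mul]⟩
  refine (Polynomial.natDegree_C_mul_le _ _).trans_lt ?_
  rw [Polynomial.natDegree_pow, Polynomial.natDegree_X_sub_C]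
  omega

lemma pair_truncPow_eq_zero {n : ℕ} (hn : 2 ≤ n) {w : ℝ →₀ ℝ} (hw : KillsPoly n w) {m M : ℝ}
    (hS : ∀ s ∈ w.support, s ∈ Set.Icc m M) {u : ℝ} (hu : u ∉ Set.Ioo m M) :
    pair w (truncPow n u) = 0 := by
  rcases le_or_gt u m with h | h
  · obtain ⟨p, hpd, hp⟩ := exists_polynomial_sub_pow n (by omega) u
    rw [← hw p hpd]
    exact pair_congr fun s hs => by rw [hp, truncPow_of_ge (h.trans (hS s hs).1)]
  · have hM : M ≤ u := not_lt.1 fun h' => hu ⟨h, h'⟩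
    exact pair_eq_zero fun s hs => truncPow_of_le hn ((hS s hs).2.trans hM)

lemma continuous_pair_truncPow (n : ℕ) (w : ℝ →₀ ℝ) : Continuous fun u => pair w (truncPow n u) := by
  simp only [pair_eq_sum (subset_refl w.support)]
  exact continuous_finsetSum _ fun s _ => continuous_const.mul (continuous_truncPow n s)

lemma exists_net (n : ℕ) (a b : ℝ) {η : ℝ} (hη : 0 < η) : ∃ G : Finset ℝ,
    (∀ s ∈ G, s ∈ Set.Icc a (b + η)) ∧ ∀ u ∈ Set.Icc a b, ∃ P ⊆ G, P.card = n ∧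
      ∀ p ∈ P, u < p ∧ p ≤ u + η := by
  set δ : ℝ := η / (n + 1) with hδ
  have hδ0 : 0 < δ := by positivity
  refine ⟨((Finset.range (⌊(b - a) / δ⌋₊ + n + 1)).image fun i : ℕ => a + i * δ).filter
    (· ≤ b + η), fun s hs => ?_, fun u hu => ?_⟩
  · obtain ⟨h1, h2⟩ := Finset.mem_filter.1 hs
    obtain ⟨i, -, rfl⟩ := Finset.mem_image.1 h1
    exact ⟨le_add_of_nonneg_right (by positivity), h2⟩
  · set i₀ := ⌊(u - a) / δ⌋₊ with hi₀
    have hua : 0 ≤ (u - a) / δ := div_nonneg (sub_nonneg.2 hu.1) hδ0.le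
    have hlo : (i₀ : ℝ) * δ ≤ u - a := (le_div_iff₀ hδ0).1 (Nat.floor_le hua)
    have hhi : u - a < (i₀ + 1 : ℝ) * δ := (div_lt_iff₀ hδ0).1 (Nat.lt_floor_add_one _)
    have hnδ : (n : ℝ) * δ ≤ η := by
      have : ((n : ℝ) + 1) * δ = η := by rw [hδ]; field_simp
      linarith
    have hP : ∀ p ∈ (Finset.range n).image fun k : ℕ => a + ((i₀ + 1 + k : ℕ) : ℝ) * δ,
        u < p ∧ p ≤ u + η := by
      intro p hp
      obtain ⟨k, hk, rfl⟩ := Finset.mem_image.1 hp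
      have hk : (k : ℝ) + 1 ≤ n := by exact_mod_cast Finset.mem_range.1 hk
      have h1 : 0 ≤ (k : ℝ) * δ := by positivity
      have h2 : ((k : ℝ) + 1) * δ ≤ n * δ := by gcongr
      push_cast
      constructor <;> nlinarith
    refine ⟨(Finset.range n).image fun k : ℕ => a + ((i₀ + 1 + k : ℕ) : ℝ) * δ, fun p hp => ?_, ?_,
      hP⟩
    · refine Finset.mem_filter.2 ⟨?_, by linarith [(hP p hp).2, hu.2]⟩
      obtain ⟨k, hk, rfl⟩ := Finset.mem_image.1 hp
      refine Finset.mem_image.2 ⟨i₀ + 1 + k, ?_, rfl⟩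
      have : i₀ ≤ ⌊(b - a) / δ⌋₊ := Nat.floor_le_floor (by gcongr; exact hu.2)
      have := Finset.mem_range.1 hk
      exact Finset.mem_range.2 (by omega)
    · rw [Finset.card_image_of_injective, Finset.card_range]
      intro k l h
      have h := mul_right_cancel₀ hδ0.ne' (add_left_cancel h)
      have : i₀ + 1 + k = i₀ + 1 + l := by exact_mod_cast h
      omega

lemma grid_le_of_card {t : ℕ → ℝ} (ht : StrictMono t) {n N : ℕ} (hn : 1 ≤ n) {P : Finset ℝ}
    (hP : P ⊆ (Finset.range N).image t) (hc : P.card = n) {j : ℕ} {v : ℝ}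
    (h : ∀ p ∈ P, t j < p ∧ p ≤ v) : t (j + n) ≤ v := by
  by_contra hv
  have hsub : P ⊆ (Finset.Ioo j (j + n)).image t := by
    intro p hp
    obtain ⟨i, -, rfl⟩ := Finset.mem_image.1 (hP hp)
    refine Finset.mem_image_of_mem t (Finset.mem_Ioo.2 ⟨ht.lt_iff_lt.1 (h _ hp).1, ?_⟩)
    exact ht.lt_iff_lt.1 ((h _ hp).2.trans_lt (not_le.1 hv))
  have := (Finset.card_le_card hsub).trans Finset.card_image_le
  rw [Nat.card_Ioo] at this
  omega

lemma pair_gridKernel_eq_zero_of_le {t : ℕ → ℝ} (ht : StrictMono t) {n : ℕ} (hn : 1 ≤ n)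
    {w : ℝ →₀ ℝ} (hw : KillsPoly n w) {j : ℕ} (h : ∀ s ∈ w.support, t (j + n) ≤ s) :
    pair w (gridKernel t n j) = 0 := by
  obtain ⟨p, hpd, hp⟩ := exists_polynomial_prod (fun k => t (j + k)) n
  rw [← hw p (by omega)]
  refine pair_congr fun s hs => ?_
  rw [hp, gridKernel, truncProd, if_pos]
  exact (ht (by omega : j + 0 < j + n)).trans_le (h s hs)

lemma pair_gridKernel_eq_zero_of_ge {t : ℕ → ℝ} {n : ℕ} {w : ℝ →₀ ℝ} {j : ℕ}
    (h : ∀ s ∈ w.support, s ≤ t j) : pair w (gridKernel t n j) = 0 :=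
  pair_eq_zero fun s hs => if_neg (h s hs).not_gt

/-- On fine grids, `gridKernel` is close to the truncated power as seen by a weight that
annihilates polynomials. -/
lemma exists_grid_approx {n : ℕ} (hn : 2 ≤ n) {w : ℝ →₀ ℝ} (hw : KillsPoly n w) {I : Set ℝ}
    (hIo : IsOpen I) (hIc : I.OrdConnected) {m M : ℝ} (hmM : m ≤ M) (hm : m ∈ I) (hM : M ∈ I)
    (hS : ∀ s ∈ w.support, s ∈ Set.Icc m M) :
    ∃ a b : ℝ, Set.Icc a b ⊆ I ∧ (∀ u ∉ Set.Icc a b, pair w (truncPow n u) = 0) ∧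
      ∀ ε > 0, ∃ G₀ : Finset ℝ, ↑G₀ ⊆ I ∧ ∀ (t : ℕ → ℝ) (N : ℕ), StrictMono t →
        G₀ ⊆ (Finset.range N).image t → ∀ j,
          (t j ∉ Set.Icc a b → pair w (gridKernel t n j) = 0) ∧
          |((n - 1).factorial : ℝ)⁻¹ * pair w (gridKernel t n j) - pair w (truncPow n (t j))|
            ≤ ε := by
  obtain ⟨a, ham, haI⟩ : ∃ a < m, a ∈ I := by
    obtain ⟨l, hl, h⟩ := exists_Ioc_subset_of_mem_nhds (hIo.mem_nhds hm) (exists_lt m)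
    obtain ⟨a, h1, h2⟩ := exists_between hl
    exact ⟨a, h2, h ⟨h1, h2.le⟩⟩
  obtain ⟨b, hMb, hbI⟩ : ∃ b > M, b ∈ I := by
    obtain ⟨l, hl, h⟩ := exists_Ico_subset_of_mem_nhds (hIo.mem_nhds hM) (exists_gt M)
    obtain ⟨b, h1, h2⟩ := exists_between hl
    exact ⟨b, h1, h ⟨h1.le, h2⟩⟩
  refine ⟨a, M, hIc.out haI hM, fun u hu => pair_truncPow_eq_zero hn hw hS fun h =>
    hu ⟨ham.le.trans h.1.le, h.2.le⟩, fun ε hε => ?_⟩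
  set B : ℝ := M - a + 1 with hB
  have hB1 : 1 ≤ B := by linarith
  set C : ℝ := ∑ s ∈ w.support, |w s| with hC
  have hC0 : 0 ≤ C := Finset.sum_nonneg fun _ _ => abs_nonneg _
  set D : ℝ := C * (n * B ^ n) + 1 with hD
  have hD0 : 0 < D := by positivity
  set η : ℝ := min (min 1 (m - a)) (min (b - M) (ε / D)) with hη
  have hη0 : 0 < η := by
    refine lt_min (lt_min one_pos (sub_pos.2 ham)) (lt_min (sub_pos.2 hMb) (by positivity))
  have hη1 : η ≤ 1 := (min_le_left _ _).trans (min_le_left _ _)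
  have hη2 : η ≤ m - a := (min_le_left _ _).trans (min_le_right _ _)
  have hη3 : η ≤ b - M := (min_le_right _ _).trans (min_le_left _ _)
  have hη4 : η * D ≤ ε := (le_div_iff₀ hD0).1 ((min_le_right _ _).trans (min_le_right _ _))
  obtain ⟨G₀, hG₀, hnet⟩ := exists_net n a M hη0
  refine ⟨G₀, fun s hs => hIc.out haI hbI ⟨(hG₀ s hs).1, by linarith [(hG₀ s hs).2]⟩,
    fun t N ht hG j => ?_⟩
  rcases lt_or_ge (t j) a with hja | hja
  · have h0 : pair w (gridKernel t n j) = 0 := by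
      obtain ⟨P, hPG, hPc, hP⟩ := hnet a ⟨le_rfl, by linarith⟩
      have := grid_le_of_card ht (by omega) (hPG.trans hG) hPc (j := j) (v := a + η)
        fun p hp => ⟨hja.trans (hP p hp).1, (hP p hp).2⟩
      exact pair_gridKernel_eq_zero_of_le ht (by omega) hw fun s hs => by linarith [(hS s hs).1]
    rw [h0, pair_truncPow_eq_zero hn hw hS fun h => absurd h.1 (by linarith)]
    simpa using hε.le
  rcases lt_or_ge M (t j) with hjM | hjM
  · have h0 : pair w (gridKernel t n j) = 0 :=
      pair_gridKernel_eq_zero_of_ge fun s hs => (hS s hs).2.trans hjM.le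
    rw [h0, pair_truncPow_eq_zero hn hw hS fun h => absurd h.2 (by linarith)]
    simpa using hε.le
  refine ⟨fun h => absurd ⟨hja, hjM⟩ h, ?_⟩
  obtain ⟨P, hPG, hPc, hP⟩ := hnet (t j) ⟨hja, hjM⟩
  have hjn := grid_le_of_card ht (by omega) (hPG.trans hG) hPc hP
  have hfac : (1 : ℝ) ≤ ((n - 1).factorial : ℝ) := by exact_mod_cast Nat.factorial_pos _
  have hpt : ∀ s ∈ w.support, |((n - 1).factorial : ℝ)⁻¹ * gridKernel t n j s -
      truncPow n (t j) s| ≤ η * (n * B ^ n) := by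
    intro s hs
    rcases le_or_gt s (t j) with h | h
    · rw [truncPow_of_le hn h, gridKernel, truncProd,
        if_neg (show ¬t (j + 0) < s from h.not_gt)]
      simp only [mul_zero, sub_zero, abs_zero]
      positivity
    · rw [truncPow_of_ge h.le, gridKernel, truncProd, if_pos (show t (j + 0) < s from h),
        div_eq_inv_mul, ← mul_sub, abs_mul,
        abs_of_nonneg (by positivity)]
      have hts : ∀ k ∈ Finset.Ico 1 n, t j ≤ t (j + k) ∧ t (j + k) ≤ t j + η := fun k hk => by
        have := Finset.mem_Ico.1 hk
        exact ⟨ht.monotone (by omega), (ht.monotone (by omega)).trans hjn⟩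
      have hsM := hS s hs
      have hpr := abs_prod_sub_prod_le (Finset.Ico 1 n) (x := fun k => s - t (j + k))
        (y := fun _ => s - t j) hB1 hη0.le
        (fun k hk => by
          have := hts k hk
          rw [abs_le]; constructor <;> linarith [hsM.1, hsM.2])
        (fun k hk => by rw [abs_le]; constructor <;> linarith [hsM.1, hsM.2])
        (fun k hk => by
          have := hts k hk
          rw [abs_le]; constructor <;> linarith)
      rw [Finset.prod_const, Nat.card_Ico] at hpr
      calc _ ≤ 1 * (((n - 1 : ℕ) : ℝ) * η * B ^ (n - 1)) :=
            mul_le_mul (inv_le_one_of_one_le₀ hfac) hpr (abs_nonneg _) zero_le_one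
        _ ≤ 1 * ((n : ℝ) * η * B ^ n) := by
            gcongr
            · omega
            · omega
        _ = _ := by ring
  rw [← pair_mul_left, ← pair_sub, pair_eq_sum subset_rfl]
  calc _ ≤ ∑ s ∈ w.support, |w s| * (η * (n * B ^ n)) := by
        refine (Finset.abs_sum_le_sum_abs _ _).trans (Finset.sum_le_sum fun s hs => ?_)
        rw [abs_mul]
        exact mul_le_mul_of_nonneg_left (hpt s hs) (abs_nonneg _)
    _ = η * (C * (n * B ^ n)) := by rw [← Finset.sum_mul]; ring
    _ ≤ η * D := by gcongr; linarith
    _ ≤ ε := hη4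

/-- A node set whose divided difference is nonnegative on all grid kernels, and bounded below on
those located in `[a, b]`. -/
lemma exists_dd_gridKernel_ge {n : ℕ} (hn : 1 ≤ n) {I : Set ℝ} (hIo : IsOpen I)
    {a b : ℝ} (ha : a ∈ I) (hb : b ∈ I) :
    ∃ (z : Finset ℝ) (γ : ℝ) (G₀ : Finset ℝ), z.card = n + 1 ∧ ↑z ⊆ I ∧ 0 < γ ∧ ↑G₀ ⊆ I ∧ z ⊆ G₀ ∧
      ∀ (t : ℕ → ℝ) (N : ℕ), StrictMono t → G₀ ⊆ (Finset.range N).image t → ∀ j,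
        0 ≤ pair (dd z) (gridKernel t n j) ∧
        (t j ∈ Set.Icc a b → γ ≤ pair (dd z) (gridKernel t n j)) := by
  rcases lt_or_ge b a with hba | hab
  · obtain ⟨l, hl, h⟩ := exists_Ioc_subset_of_mem_nhds (hIo.mem_nhds ha) (exists_lt a)
    obtain ⟨z, hz, hzc⟩ := (Set.Ioo_infinite hl).exists_subset_card_eq (n + 1)
    have hzI : (z : Set ℝ) ⊆ I := hz.trans (Set.Ioo_subset_Ioc_self.trans h)
    exact ⟨z, 1, z, hzc, hzI, one_pos, hzI, subset_rfl, fun t N ht hG j =>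
      ⟨pair_dd_gridKernel_nonneg ht hn hzc hG j, fun hj => by linarith [hj.1, hj.2]⟩⟩
  obtain ⟨l, hl, hlI⟩ := exists_Ioc_subset_of_mem_nhds (hIo.mem_nhds ha) (exists_lt a)
  obtain ⟨Y, hY, hYc⟩ := (Set.Ioo_infinite hl).exists_subset_card_eq n
  have hYI : (Y : Set ℝ) ⊆ I := hY.trans (Set.Ioo_subset_Ioc_self.trans hlI)
  obtain ⟨r, hr, hrI⟩ := exists_Ico_subset_of_mem_nhds (hIo.mem_nhds hb) (exists_gt b)
  obtain ⟨X, hbX, hXr⟩ := exists_between hr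
  obtain ⟨b', hbb', hb'X⟩ := exists_between hbX
  obtain ⟨P, hP, hPc⟩ := (Set.Ioo_infinite hbb').exists_subset_card_eq n
  have hXI : X ∈ I := hrI ⟨hbX.le, hXr⟩
  have hYX : ∀ y ∈ Y, y < X := fun y hy => by linarith [(hY hy).2]
  have hXY : X ∉ Y := fun h => (hYX X h).false
  have hzI : ((insert X Y : Finset ℝ) : Set ℝ) ⊆ I := by
    rw [Finset.coe_insert]
    exact Set.insert_subset hXI hYI
  have hzc : (insert X Y).card = n + 1 := by rw [Finset.card_insert_of_notMem hXY, hYc]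
  have hcpos : 0 < ∏ y ∈ Y, (X - y)⁻¹ :=
    Finset.prod_pos fun y hy => inv_pos.2 (sub_pos.2 (hYX y hy))
  refine ⟨insert X Y, (∏ y ∈ Y, (X - y)⁻¹) * (X - b') ^ (n - 1), insert X Y ∪ P, hzc, hzI,
    mul_pos hcpos (pow_pos (sub_pos.2 hb'X) _), ?_, Finset.subset_union_left, ?_⟩
  · rw [Finset.coe_union]
    exact Set.union_subset hzI (hP.trans fun p hp => hrI ⟨hp.1.le, by linarith [hp.2]⟩)
  · intro t N ht hG j
    refine ⟨pair_dd_gridKernel_nonneg ht hn hzc (Finset.subset_union_left.trans hG) j,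
      fun hj => ?_⟩
    have hjn : t (j + n) ≤ b' := grid_le_of_card ht hn (Finset.subset_union_right.trans hG) hPc
      fun p hp => ⟨hj.2.trans_lt (hP hp).1, (hP hp).2.le⟩
    rw [pair_dd, Finset.sum_insert hXY, Finset.erase_insert hXY, Finset.sum_eq_zero (s := Y)
      fun y hy => by
        rw [gridKernel, truncProd, if_neg, mul_zero]
        exact not_lt.2 ((hY hy).2.le.trans hj.1), add_zero]
    refine mul_le_mul_of_nonneg_left ?_ hcpos.le
    rw [gridKernel, truncProd, if_pos (show t (j + 0) < X from hj.2.trans_lt hbX)]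
    have hc : n - 1 = (Finset.Ico 1 n).card := by simp
    rw [hc, ← Finset.prod_const]
    refine Finset.prod_le_prod (fun _ _ => (sub_pos.2 hb'X).le) fun k hk => ?_
    have := Finset.mem_Ico.1 hk
    have : t (j + k) ≤ t (j + n) := ht.monotone (by omega)
    linarith

open Filter Topology

lemma exists_measure_of_eventually_bounded {X : Type*} [TopologicalSpace X] [LocallyCompactSpace X]
    [T2Space X] [MeasurableSpace X] [BorelSpace X] {ι : Type*} (l : Filter ι) [l.NeBot]
    (Λ : ι → CompactlySupportedContinuousMap X ℝ →ₗ[ℝ] ℝ)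
    (hpos : ∀ i φ, 0 ≤ φ → 0 ≤ Λ i φ) (hbdd : ∀ φ, ∃ C, ∀ᶠ i in l, |Λ i φ| ≤ C) :
    ∃ ν : Measure X, IsFiniteMeasureOnCompacts ν ∧
      ∀ φ c, Tendsto (fun i => Λ i φ) l (𝓝 c) → ∫ u, φ u ∂ν = c := by
  set 𝒰 : Ultrafilter ι := Ultrafilter.of l
  have h𝒰 : (𝒰 : Filter ι) ≤ l := Ultrafilter.of_le l
  have hlim : ∀ φ, ∃ L, Tendsto (fun i => Λ i φ) 𝒰 (𝓝 L) := by
    intro φ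
    obtain ⟨C, hC⟩ := hbdd φ
    have hmem : ((𝒰.map fun i => Λ i φ : Ultrafilter ℝ) : Filter ℝ) ≤ 𝓟 (Set.Icc (-C) C) := by
      rw [le_principal_iff]
      exact h𝒰 (hC.mono fun i hi => abs_le.1 hi)
    obtain ⟨L, -, hL⟩ := isCompact_Icc.ultrafilter_le_nhds _ hmem
    exact ⟨L, hL⟩
  choose L hL using hlim
  let Λ₀ : CompactlySupportedContinuousMap X ℝ →ₗ[ℝ] ℝ :=
    { toFun := L
      map_add' := fun φ ψ => tendsto_nhds_unique (hL _) (by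
        simpa only [map_add] using (hL φ).add (hL ψ))
      map_smul' := fun c φ => tendsto_nhds_unique (hL _) (by
        simpa only [map_smul, RingHom.id_apply] using (hL φ).const_smul c) }
  have hΛ₀ : ∀ φ, 0 ≤ φ → 0 ≤ Λ₀ φ := fun φ hφ =>
    ge_of_tendsto (hL φ) (Eventually.of_forall fun i => hpos i φ hφ)
  refine ⟨RealRMK.rieszMeasure (PositiveLinearMap.mk₀ Λ₀ hΛ₀), inferInstance, fun φ c hc => ?_⟩
  rw [RealRMK.integral_rieszMeasure]
  exact tendsto_nhds_unique (hL φ) (hc.mono_left h𝒰)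

section gridFunctional

variable {d : ℕ}

/-- A strictly increasing sequence whose first terms enumerate `G`. -/
noncomputable def enum (G : Finset ℝ) : ℕ → ℝ := (exists_strictMono_enum G).choose

lemma strictMono_enum (G : Finset ℝ) : StrictMono (enum G) :=
  (exists_strictMono_enum G).choose_spec.1

lemma image_enum (G : Finset ℝ) : (Finset.range G.card).image (enum G) = G :=
  (exists_strictMono_enum G).choose_spec.2

lemma enum_mem {G : Finset ℝ} {j : ℕ} (hj : j < G.card) : enum G j ∈ G := by
  have := Finset.mem_image_of_mem (enum G) (Finset.mem_range.2 hj)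
  rwa [image_enum] at this

/-- The mass at the grid point with index `J` of the discrete measure attached to `f`. -/
noncomputable def gridMass (f : (Fin d → ℝ) → ℝ) (n : Fin d → ℕ) (Γ : Fin d → Finset ℝ)
    (J : Fin d → ℕ) : ℝ :=
  (∏ i, ((n i - 1).factorial : ℝ)) * multiEval (fun i => gridDiff (enum (Γ i)) (n i) (J i)) f

/-- The indices of the atoms of the discrete measure. -/
def gridIndex (n : Fin d → ℕ) (Γ : Fin d → Finset ℝ) : Finset (Fin d → ℕ) :=
  Fintype.piFinset fun i => Finset.range ((Γ i).card - n i)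

/-- Integration with respect to the discrete measure attached to `f` on the grid `Γ`. -/
noncomputable def gridFunctional (f : (Fin d → ℝ) → ℝ) (n : Fin d → ℕ) (Γ : Fin d → Finset ℝ) :
    ((Fin d → ℝ) → ℝ) →ₗ[ℝ] ℝ :=
  ∑ J ∈ gridIndex n Γ, gridMass f n Γ J • LinearMap.proj fun i => enum (Γ i) (J i)

lemma gridFunctional_apply (f : (Fin d → ℝ) → ℝ) (n : Fin d → ℕ) (Γ : Fin d → Finset ℝ)
    (φ : (Fin d → ℝ) → ℝ) : gridFunctional f n Γ φ =
      ∑ J ∈ gridIndex n Γ, gridMass f n Γ J * φ fun i => enum (Γ i) (J i) := by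
  simp [gridFunctional, LinearMap.sum_apply]

lemma enum_add_mem {n : Fin d → ℕ} {Γ : Fin d → Finset ℝ} {J : Fin d → ℕ} (hJ : J ∈ gridIndex n Γ)
    (i : Fin d) {k : ℕ} (hk : k ≤ n i) : enum (Γ i) (J i + k) ∈ Γ i := by
  have := Finset.mem_range.1 (Fintype.mem_piFinset.1 hJ i)
  exact enum_mem (by omega)

lemma multiEval_eq_sum_gridMass (f : (Fin d → ℝ) → ℝ) {n : Fin d → ℕ} (hn : ∀ i, 1 ≤ n i)
    {Γ : Fin d → Finset ℝ} {w : Fin d → ℝ →₀ ℝ} (hw : ∀ i, KillsPoly (n i) (w i))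
    (hΓ : ∀ i, (w i).support ⊆ Γ i) :
    multiEval w f = ∑ J ∈ gridIndex n Γ, gridMass f n Γ J *
      ∏ i, ((n i - 1).factorial : ℝ)⁻¹ * pair (w i) (gridKernel (enum (Γ i)) (n i) (J i)) := by
  rw [multiEval_sum_smul _ _ _ fun i => eq_sum_gridDiff (strictMono_enum (Γ i)) (hn i) (hw i)
    (by rw [image_enum]; exact hΓ i)]
  refine Finset.sum_congr rfl fun J _ => ?_
  have h0 : (∏ i, ((n i - 1).factorial : ℝ)) ≠ 0 :=
    Finset.prod_ne_zero_iff.2 fun i _ => by positivity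
  rw [gridMass, Finset.prod_mul_distrib, Finset.prod_inv_distrib]
  field_simp

lemma IsBoxConvexOn.multiEval_dd_nonneg {I : Fin d → Set ℝ} {n : Fin d → ℕ}
    {f : (Fin d → ℝ) → ℝ} (hf : IsBoxConvexOn I n f) {z : Fin d → Finset ℝ}
    (hz : ∀ i, (z i).card = n i + 1) (hzI : ∀ i, ↑(z i) ⊆ I i) :
    0 ≤ multiEval (fun i => dd (z i)) f := by
  have hinj : ∀ i, Function.Injective ((z i).orderEmbOfFin (hz i)) :=
    fun i => ((z i).orderEmbOfFin (hz i)).injective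
  have h := hf (fun i => (z i).orderEmbOfFin (hz i))
    (fun i j => hzI i (Finset.orderEmbOfFin_mem _ _ j)) hinj
  rw [multiDividedDiff_eq_multiEval _ _ hinj] at h
  simpa only [Finset.image_orderEmbOfFin_univ] using h

lemma IsBoxConvexOn.gridMass_nonneg {I : Fin d → Set ℝ} {n : Fin d → ℕ} {f : (Fin d → ℝ) → ℝ}
    (hf : IsBoxConvexOn I n f) {Γ : Fin d → Finset ℝ} (hΓ : ∀ i, ↑(Γ i) ⊆ I i) {J : Fin d → ℕ}
    (hJ : J ∈ gridIndex n Γ) : 0 ≤ gridMass f n Γ J := by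
  refine mul_nonneg (Finset.prod_nonneg fun _ _ => by positivity) ?_
  rw [multiEval_sum_smul (fun _ => {()})
    (fun i _ => enum (Γ i) (J i + n i) - enum (Γ i) (J i))
    (fun i _ => dd (block (enum (Γ i)) (J i) (n i))) (fun i => by rw [Finset.sum_singleton]; rfl)]
  refine Finset.sum_nonneg fun _ _ => mul_nonneg (Finset.prod_nonneg fun i _ => ?_) ?_
  · exact sub_nonneg.2 ((strictMono_enum _).monotone (by omega))
  · refine hf.multiEval_dd_nonneg (fun i => card_block (strictMono_enum _) _ _) fun i s hs => ?_
    obtain ⟨k, hk, rfl⟩ := mem_block.1 hs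
    exact hΓ i (enum_add_mem hJ i hk)

lemma enum_mem_box {I : Fin d → Set ℝ} {n : Fin d → ℕ} {Γ : Fin d → Finset ℝ}
    (hΓ : ∀ i, ↑(Γ i) ⊆ I i) {J : Fin d → ℕ} (hJ : J ∈ gridIndex n Γ) :
    (fun i => enum (Γ i) (J i)) ∈ box I :=
  fun i => hΓ i (enum_add_mem hJ i (Nat.zero_le _))

lemma IsBoxConvexOn.gridFunctional_mono {I : Fin d → Set ℝ} {n : Fin d → ℕ} {f : (Fin d → ℝ) → ℝ}
    (hf : IsBoxConvexOn I n f) {Γ : Fin d → Finset ℝ} (hΓ : ∀ i, ↑(Γ i) ⊆ I i)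
    {φ ψ : (Fin d → ℝ) → ℝ} (h : ∀ u ∈ box I, φ u ≤ ψ u) :
    gridFunctional f n Γ φ ≤ gridFunctional f n Γ ψ := by
  rw [gridFunctional_apply, gridFunctional_apply]
  exact Finset.sum_le_sum fun J hJ =>
    mul_le_mul_of_nonneg_left (h _ (enum_mem_box hΓ hJ)) (hf.gridMass_nonneg hΓ hJ)

/-- A family of finite subsets of the `I i`, as a family of finite sets of reals. -/
def nodes {I : Fin d → Set ℝ} (G : (i : Fin d) → Finset (I i)) (i : Fin d) : Finset ℝ :=
  (G i).map (Function.Embedding.subtype _)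

lemma nodes_subset {I : Fin d → Set ℝ} (G : (i : Fin d) → Finset (I i)) (i : Fin d) :
    ↑(nodes G i) ⊆ I i := by
  intro s hs
  obtain ⟨a, -, rfl⟩ := Finset.mem_map.1 hs
  exact a.2

lemma eventually_subset_nodes {I : Fin d → Set ℝ} {G₀ : Fin d → Finset ℝ}
    (hG₀ : ∀ i, ↑(G₀ i) ⊆ I i) :
    ∀ᶠ G : (i : Fin d) → Finset (I i) in atTop, ∀ i, G₀ i ⊆ nodes G i := by
  classical
  filter_upwards [eventually_ge_atTop fun i => (G₀ i).subtype (· ∈ I i)] with G hG i s hs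
  exact Finset.mem_map.2 ⟨⟨s, hG₀ i hs⟩, hG i (Finset.mem_subtype.2 hs), rfl⟩

lemma exists_box_of_isCompact {I : Fin d → Set ℝ} {K : Set (Fin d → ℝ)} (hK : IsCompact K)
    (hKI : K ⊆ box I) (hne : K.Nonempty) : ∃ a ∈ box I, ∃ b ∈ box I, K ⊆ Set.Icc a b := by
  have hc : ∀ i, IsCompact ((fun u : Fin d → ℝ => u i) '' K) :=
    fun i => hK.image (continuous_apply i)
  have hm : ∀ i, ∃ m ∈ I i, ∀ u ∈ K, m ≤ u i := fun i => by
    obtain ⟨m, ⟨v, hv, rfl⟩, h⟩ := (hc i).exists_isLeast (hne.image _)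
    exact ⟨_, hKI hv i, fun u hu => h ⟨u, hu, rfl⟩⟩
  have hM : ∀ i, ∃ m ∈ I i, ∀ u ∈ K, u i ≤ m := fun i => by
    obtain ⟨m, ⟨v, hv, rfl⟩, h⟩ := (hc i).exists_isGreatest (hne.image _)
    exact ⟨_, hKI hv i, fun u hu => h ⟨u, hu, rfl⟩⟩
  choose a ha ha' using hm
  choose b hb hb' using hM
  exact ⟨a, ha, b, hb, fun u hu => ⟨fun i => ha' i u hu, fun i => hb' i u hu⟩⟩

/-- The discrete measures are eventually bounded on compact subsets of the box. -/
lemma IsBoxConvexOn.exists_gridFunctional_indicator_le {I : Fin d → Set ℝ}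
    (hIo : ∀ i, IsOpen (I i)) {n : Fin d → ℕ} (hn : ∀ i, 1 ≤ n i) {f : (Fin d → ℝ) → ℝ}
    (hf : IsBoxConvexOn I n f) {K : Set (Fin d → ℝ)} (hK : IsCompact K) (hKI : K ⊆ box I) :
    ∃ C, ∀ᶠ G : (i : Fin d) → Finset (I i) in atTop,
      gridFunctional f n (nodes G) (K.indicator 1) ≤ C := by
  classical
  rcases K.eq_empty_or_nonempty with rfl | hne
  · exact ⟨0, Eventually.of_forall fun G => by simp [gridFunctional_apply]⟩
  obtain ⟨a, ha, b, hb, hKab⟩ := exists_box_of_isCompact hK hKI hne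
  choose z γ G₀ hzc hzI hγ hG₀ hzG hz using
    fun i => exists_dd_gridKernel_ge (hn i) (hIo i) (ha i) (hb i)
  set c : ℝ := ∏ i, ((n i - 1).factorial : ℝ)⁻¹ * γ i with hc
  have hc0 : 0 < c := Finset.prod_pos fun i _ => mul_pos (by positivity) (hγ i)
  refine ⟨multiEval (fun i => dd (z i)) f / c, ?_⟩
  filter_upwards [eventually_subset_nodes hG₀] with G hG
  rw [le_div_iff₀ hc0, multiEval_eq_sum_gridMass f hn (fun i => killsPoly_dd (hzc i))
    (fun i => (support_dd _).trans ((hzG i).trans (hG i))), gridFunctional_apply, Finset.sum_mul]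
  refine Finset.sum_le_sum fun J hJ => ?_
  rw [mul_assoc]
  refine mul_le_mul_of_nonneg_left ?_ (hf.gridMass_nonneg (nodes_subset G) hJ)
  have hzz := fun i => hz i (enum (nodes G i)) (nodes G i).card (strictMono_enum _)
    (by rw [image_enum]; exact hG i) (J i)
  by_cases hu : (fun i => enum (nodes G i) (J i)) ∈ K
  · rw [Set.indicator_of_mem hu, Pi.one_apply, one_mul]
    refine Finset.prod_le_prod (fun i _ => mul_nonneg (by positivity) (hγ i).le) fun i _ => ?_
    exact mul_le_mul_of_nonneg_left ((hzz i).2 ⟨(hKab hu).1 i, (hKab hu).2 i⟩) (by positivity)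
  · rw [Set.indicator_of_notMem hu, zero_mul]
    exact Finset.prod_nonneg fun i _ => mul_nonneg (by positivity) (hzz i).1

lemma isCompact_pi_Icc_subset {I : Fin d → Set ℝ} {a b : Fin d → ℝ}
    (h : ∀ i, Set.Icc (a i) (b i) ⊆ I i) :
    IsCompact (Set.Icc a b) ∧ Set.Icc a b ⊆ box I :=
  ⟨isCompact_Icc, fun _ hu i => h i ⟨hu.1 i, hu.2 i⟩⟩

lemma IsBoxConvexOn.tendsto_gridFunctional {I : Fin d → Set ℝ}
    (hIo : ∀ i, IsOpen (I i)) (hIc : ∀ i, (I i).OrdConnected) {n : Fin d → ℕ} (hn : ∀ i, 2 ≤ n i)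
    {f : (Fin d → ℝ) → ℝ} (hf : IsBoxConvexOn I n f) {w : Fin d → ℝ →₀ ℝ}
    (hw : ∀ i, KillsPoly (n i) (w i)) (hwI : ∀ i, ↑(w i).support ⊆ I i) (hw0 : ∀ i, w i ≠ 0) :
    ∃ a b : Fin d → ℝ, (∀ i, Set.Icc (a i) (b i) ⊆ I i) ∧
      (∀ i, ∀ u ∉ Set.Icc (a i) (b i), pair (w i) (truncPow (n i) u) = 0) ∧
      Tendsto (fun G : (i : Fin d) → Finset (I i) => gridFunctional f n (nodes G)
        fun u => ∏ i, pair (w i) (truncPow (n i) (u i))) atTop (𝓝 (multiEval w f)) := by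
  classical
  have hne : ∀ i, (w i).support.Nonempty := fun i => Finsupp.support_nonempty_iff.2 (hw0 i)
  choose a b hab hout happ using fun i => exists_grid_approx (hn i) (hw i) (hIo i) (hIc i)
    (Finset.min'_le _ _ (Finset.max'_mem _ (hne i))) (hwI i (Finset.min'_mem _ (hne i)))
    (hwI i (Finset.max'_mem _ (hne i)))
    fun s hs => ⟨Finset.min'_le _ s hs, Finset.le_max' _ s hs⟩
  refine ⟨a, b, hab, hout, ?_⟩
  obtain ⟨hK, hKI⟩ := isCompact_pi_Icc_subset hab
  obtain ⟨C, hC⟩ := hf.exists_gridFunctional_indicator_le hIo (fun i => by have := hn i; omega) hK hKI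
  have hbd : ∀ i, ∃ B, ∀ u ∈ Set.Icc (a i) (b i), |pair (w i) (truncPow (n i) u)| ≤ B := fun i =>
    isCompact_Icc.exists_bound_of_continuousOn (continuous_pair_truncPow (n i) (w i)).continuousOn
  choose B' hB' using hbd
  set B : ℝ := 2 + ∑ i, |B' i| with hB
  have hBi : ∀ i, |B' i| + 2 ≤ B := fun i => by
    have := Finset.single_le_sum (f := fun i => |B' i|) (fun i _ => abs_nonneg _)
      (Finset.mem_univ i)
    linarith
  have hB1 : 1 ≤ B := by
    have : 0 ≤ ∑ i, |B' i| := Finset.sum_nonneg fun i _ => abs_nonneg _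
    linarith
  rw [Metric.tendsto_nhds]
  intro ε hε
  set D : ℝ := (d * B ^ d) * (|C| + 1) + 1 with hD
  have hD0 : 0 < D := by positivity
  set η : ℝ := min 1 (ε / (2 * D)) with hη
  have hη0 : 0 < η := lt_min one_pos (by positivity)
  have hη1 : η ≤ 1 := min_le_left _ _
  have hη2 : η * D < ε := by
    have : η * (2 * D) ≤ ε := (le_div_iff₀ (by positivity)).1 (min_le_right _ _)
    have : 0 < η * D := by positivity
    linarith
  choose G₀ hG₀ hG₀' using fun i => happ i η hη0
  filter_upwards [hC, eventually_subset_nodes hG₀, eventually_subset_nodes hwI] with G hGC hG hGw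
  rw [Real.dist_eq, abs_sub_comm, multiEval_eq_sum_gridMass f (fun i => by have := hn i; omega) hw
    hGw, gridFunctional_apply, ← Finset.sum_sub_distrib]
  refine lt_of_le_of_lt ?_ hη2
  have hterm : ∀ J ∈ gridIndex n (nodes G), |gridMass f n (nodes G) J * (∏ i,
      ((n i - 1).factorial : ℝ)⁻¹ * pair (w i) (gridKernel (enum (nodes G i)) (n i) (J i))) -
      gridMass f n (nodes G) J * (∏ i, pair (w i) (truncPow (n i) (enum (nodes G i) (J i))))| ≤
      gridMass f n (nodes G) J * (Set.Icc a b).indicator 1 (fun i => enum (nodes G i) (J i)) *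
        (d * η * B ^ d) := by
    intro J hJ
    have hm := hf.gridMass_nonneg (nodes_subset G) hJ
    have hg := fun i => hG₀' i (enum (nodes G i)) (nodes G i).card (strictMono_enum _)
      (by rw [image_enum]; exact hG i) (J i)
    rw [← mul_sub, abs_mul, abs_of_nonneg hm, mul_assoc]
    refine mul_le_mul_of_nonneg_left ?_ hm
    by_cases hu : (fun i => enum (nodes G i) (J i)) ∈ Set.Icc a b
    · rw [Set.indicator_of_mem hu, Pi.one_apply, one_mul]
      have hk : ∀ i, |pair (w i) (truncPow (n i) (enum (nodes G i) (J i)))| ≤ |B' i| := fun i =>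
        (hB' i _ ⟨hu.1 i, hu.2 i⟩).trans (le_abs_self _)
      have := abs_prod_sub_prod_le Finset.univ hB1 hη0.le
        (fun i _ => ?_) (fun i _ => (hk i).trans (by linarith [hBi i])) fun i _ => (hg i).2
      · simpa using this
      · have h1 := abs_le.1 (hg i).2
        have h2 := abs_le.1 (hk i)
        have h3 := hBi i
        rw [abs_le]
        constructor <;> linarith
    · obtain ⟨i, hi⟩ : ∃ i, enum (nodes G i) (J i) ∉ Set.Icc (a i) (b i) := by
        by_contra! h
        exact hu ⟨fun i => (h i).1, fun i => (h i).2⟩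
      rw [Finset.prod_eq_zero (Finset.mem_univ i) (by rw [(hg i).1 hi, mul_zero]),
        Finset.prod_eq_zero (Finset.mem_univ i) (hout i _ hi), sub_zero, abs_zero,
        Set.indicator_of_notMem hu, zero_mul]
  refine (Finset.abs_sum_le_sum_abs _ _).trans ((Finset.sum_le_sum hterm).trans ?_)
  rw [← Finset.sum_mul, ← gridFunctional_apply]
  calc _ ≤ |C| * (d * η * B ^ d) := by
        gcongr
        exact hGC.trans (le_abs_self C)
    _ = η * (d * B ^ d * |C|) := by ring
    _ ≤ η * D := by
        gcongr
        have : 0 ≤ (d : ℝ) * B ^ d := by positivity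
        rw [hD]
        linarith

end gridFunctional

lemma isOpen_box {d : ℕ} {I : Fin d → Set ℝ} (hIo : ∀ i, IsOpen (I i)) : IsOpen (box I) := by
  have : box I = Set.univ.pi I := by ext; simp [box]
  rw [this]
  exact isOpen_set_pi Set.finite_univ fun i _ => hIo i

/-- The measure of mixed differences of a box-convex function. -/
theorem IsBoxConvexOn.exists_measure {d : ℕ} {I : Fin d → Set ℝ} (hIo : ∀ i, IsOpen (I i))
    (hIc : ∀ i, (I i).OrdConnected) {n : Fin d → ℕ} (hn : ∀ i, 2 ≤ n i) {f : (Fin d → ℝ) → ℝ}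
    (hf : IsBoxConvexOn I n f) :
    ∃ μ : Measure (Fin d → ℝ), (∀ K ⊆ box I, IsCompact K → μ K < ⊤) ∧
      ∀ w : Fin d → ℝ →₀ ℝ, (∀ i, KillsPoly (n i) (w i)) → (∀ i, ↑(w i).support ⊆ I i) →
        multiEval w f = ∫ u in box I, ∏ i, pair (w i) (truncPow (n i) (u i)) ∂μ := by
  classical
  have hbo := isOpen_box hIo
  have : LocallyCompactSpace (box I) := hbo.locallyCompactSpace
  let ext : CompactlySupportedContinuousMap (box I) ℝ →ₗ[ℝ] ((Fin d → ℝ) → ℝ) :=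
    Function.ExtendByZero.linearMap ℝ (Subtype.val : box I → Fin d → ℝ) ∘ₗ
      { toFun := fun φ => φ, map_add' := fun _ _ => rfl, map_smul' := fun _ _ => rfl }
  have hext : ∀ φ (u : Fin d → ℝ) (hu : u ∈ box I), ext φ u = φ ⟨u, hu⟩ := fun φ u hu =>
    Subtype.val_injective.extend_apply φ 0 ⟨u, hu⟩
  obtain ⟨ν, hν, hlim⟩ := exists_measure_of_eventually_bounded
    (atTop : Filter ((i : Fin d) → Finset (I i)))
    (fun G => gridFunctional f n (nodes G) ∘ₗ ext)
    (fun G φ hφ => by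
      rw [← map_zero (gridFunctional f n (nodes G))]
      refine hf.gridFunctional_mono (nodes_subset G) fun u hu => ?_
      rw [hext φ u hu]
      exact hφ ⟨u, hu⟩)
    (fun φ => by
      have hKc : IsCompact (Subtype.val '' tsupport φ : Set (Fin d → ℝ)) :=
        φ.hasCompactSupport.isCompact.image continuous_subtype_val
      obtain ⟨C, hC⟩ := hf.exists_gridFunctional_indicator_le hIo
        (fun i => by have := hn i; omega) hKc (by rintro _ ⟨u, -, rfl⟩; exact u.2)
      obtain ⟨B, hB⟩ := φ.hasCompactSupport.exists_bound_of_continuous φ.continuous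
      refine ⟨|B| * C, hC.mono fun G hG => ?_⟩
      have hle : ∀ u ∈ box I, |ext φ u| ≤
          (|B| • (Subtype.val '' tsupport φ : Set (Fin d → ℝ)).indicator 1 :
            (Fin d → ℝ) → ℝ) u := fun u hu => by
        rw [hext φ u hu, Pi.smul_apply, smul_eq_mul]
        by_cases h : (⟨u, hu⟩ : box I) ∈ tsupport φ
        · rw [Set.indicator_of_mem (Set.mem_image_of_mem Subtype.val h), Pi.one_apply, mul_one]
          exact (hB _).trans (le_abs_self B)
        · rw [image_eq_zero_of_notMem_tsupport h, abs_zero]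
          exact mul_nonneg (abs_nonneg _) (Set.indicator_nonneg (fun _ _ => zero_le_one) _)
      have h1 := hf.gridFunctional_mono (nodes_subset G) fun u hu =>
        (le_abs_self _).trans (hle u hu)
      have h2 := hf.gridFunctional_mono (nodes_subset G) (φ := -ext φ)
        fun u hu => (neg_le_abs _).trans (hle u hu)
      rw [map_smul, smul_eq_mul] at h1 h2
      rw [map_neg] at h2
      have h3 := mul_le_mul_of_nonneg_left hG (abs_nonneg B)
      exact abs_le.2 ⟨by simp only [LinearMap.comp_apply]; linarith,
        by simp only [LinearMap.comp_apply]; linarith⟩)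
  have hemb : MeasurableEmbedding (Subtype.val : box I → Fin d → ℝ) :=
    MeasurableEmbedding.subtype_coe hbo.measurableSet
  refine ⟨ν.map Subtype.val, fun K hKI hK => ?_, fun w hw hwI => ?_⟩
  · rw [hemb.map_apply]
    refine IsCompact.measure_lt_top ?_
    exact Topology.IsInducing.subtypeVal.isCompact_preimage' hK (by simpa using hKI)
  · by_cases hw0 : ∃ i, w i = 0
    · obtain ⟨i, hi⟩ := hw0
      have h1 : ∀ u : Fin d → ℝ, ∏ i, pair (w i) (truncPow (n i) (u i)) = 0 := fun u =>
        Finset.prod_eq_zero (Finset.mem_univ i) (by simp [pair, hi])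
      simp only [h1, integral_zero]
      exact Finset.sum_eq_zero fun s _ => by
        rw [Finset.prod_eq_zero (Finset.mem_univ i) (by simp [hi]), zero_mul]
    push Not at hw0
    obtain ⟨a, b, hab, hout, ht⟩ := hf.tendsto_gridFunctional hIo hIc hn hw hwI hw0
    obtain ⟨hK, hKI⟩ := isCompact_pi_Icc_subset hab
    have hcont : Continuous fun u : Fin d → ℝ => ∏ i, pair (w i) (truncPow (n i) (u i)) :=
      continuous_finsetProd _ fun i _ =>
        (continuous_pair_truncPow (n i) (w i)).comp (continuous_apply i)
    let φ : CompactlySupportedContinuousMap (box I) ℝ :=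
      { toFun := fun u => ∏ i, pair (w i) (truncPow (n i) (u.1 i))
        continuous_toFun := hcont.comp continuous_subtype_val
        hasCompactSupport' := by
          refine HasCompactSupport.intro (K := Subtype.val ⁻¹' Set.Icc a b)
            (Topology.IsInducing.subtypeVal.isCompact_preimage' hK (by simpa using hKI))
            fun u hu => ?_
          obtain ⟨i, hi⟩ : ∃ i, u.1 i ∉ Set.Icc (a i) (b i) := by
            by_contra! h
            exact hu ⟨fun i => (h i).1, fun i => (h i).2⟩
          exact Finset.prod_eq_zero (Finset.mem_univ i) (hout i _ hi) }
    have hφ : ∫ u, φ u ∂ν = multiEval w f := by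
      refine hlim φ _ (ht.congr fun G => ?_)
      rw [LinearMap.comp_apply, gridFunctional_apply, gridFunctional_apply]
      refine Finset.sum_congr rfl fun J hJ => ?_
      rw [hext φ _ (enum_mem_box (nodes_subset G) hJ)]
      rfl
    rw [← hφ, hemb.setIntegral_map]
    simp only [Subtype.coe_preimage_self, Measure.restrict_univ]
    rfl

/-- The one-dimensional spline kernel: its left or right version according to the position of `u`
with respect to `α`. -/
noncomputable def splineFactor (n : ℕ) (α u s : ℝ) : ℝ :=
  if u ≤ α then (-1) ^ n * ((s - u)⁻ ^ (n - 1) / ((n - 1).factorial : ℝ))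
  else (s - u)⁺ ^ (n - 1) / ((n - 1).factorial : ℝ)

lemma splineFactor_eq {n : ℕ} (hn : 2 ≤ n) (α u s : ℝ) : splineFactor n α u s =
    truncPow n u s - if u ≤ α then (s - u) ^ (n - 1) / ((n - 1).factorial : ℝ) else 0 := by
  unfold splineFactor
  split_ifs
  · rcases le_total s u with h | h
    · rw [truncPow_of_le hn h, negPart_eq_neg.2 (sub_nonpos.2 h)]
      obtain ⟨m, rfl⟩ : ∃ m, n = m + 1 := ⟨n - 1, by omega⟩
      rw [Nat.add_sub_cancel, neg_pow (s - u) m, zero_sub, pow_succ]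
      have : ((-1 : ℝ) ^ m) * (-1) ^ m = 1 := by rw [← mul_pow]; simp
      linear_combination (-(s - u) ^ m / (m.factorial : ℝ)) * this
    · rw [truncPow_of_ge h, negPart_eq_zero.2 (sub_nonneg.2 h), zero_pow (by omega)]
      simp
  · rw [truncPow, sub_zero]

lemma pair_splineFactor {n : ℕ} (hn : 2 ≤ n) {w : ℝ →₀ ℝ} (hw : KillsPoly n w) (α u : ℝ) :
    pair w (splineFactor n α u) = pair w (truncPow n u) := by
  rw [show splineFactor n α u = fun s => truncPow n u s -
    if u ≤ α then (s - u) ^ (n - 1) / ((n - 1).factorial : ℝ) else 0 from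
    funext fun s => splineFactor_eq hn α u s, pair_sub, sub_eq_self]
  split_ifs
  · obtain ⟨p, hpd, hp⟩ := exists_polynomial_sub_pow n (by omega) u
    simpa only [hp] using hw p hpd
  · exact pair_eq_zero fun _ _ => rfl

lemma splineFactor_eq_zero {n : ℕ} (hn : 2 ≤ n) {α u s : ℝ} (hu : u ∉ Set.uIcc α s) :
    splineFactor n α u s = 0 := by
  rw [Set.uIcc, Set.mem_Icc, not_and_or, not_le, not_le, lt_inf_iff, sup_lt_iff] at hu
  unfold splineFactor
  rcases hu with ⟨h1, h2⟩ | ⟨h1, h2⟩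
  · rw [if_pos h1.le, negPart_eq_zero.2 (sub_nonneg.2 h2.le), zero_pow (by omega)]
    simp
  · rw [if_neg h1.not_ge, posPart_eq_zero.2 (sub_nonpos.2 h2.le), zero_pow (by omega)]
    simp

lemma measurable_splineFactor (n : ℕ) (α s : ℝ) : Measurable fun u => splineFactor n α u s := by
  unfold splineFactor
  simp only [posPart_def, negPart_def]
  exact Measurable.ite measurableSet_Iic (by fun_prop) (by fun_prop)

lemma abs_splineFactor_le {n : ℕ} {α u s : ℝ} (hu : u ∈ Set.uIcc α s) :
    |splineFactor n α u s| ≤ |s - α| ^ (n - 1) := by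
  have h : |s - u| ≤ |s - α| := Set.abs_sub_right_of_mem_uIcc hu
  have hfac : (1 : ℝ) ≤ ((n - 1).factorial : ℝ) := by exact_mod_cast Nat.factorial_pos _
  have key : ∀ y : ℝ, 0 ≤ y → y ≤ |s - u| →
      |y ^ (n - 1) / ((n - 1).factorial : ℝ)| ≤ |s - α| ^ (n - 1) := fun y h0 hy => by
    rw [abs_of_nonneg (by positivity)]
    exact (div_le_self (by positivity) hfac).trans (pow_le_pow_left₀ h0 (hy.trans h) _)
  unfold splineFactor
  split_ifs
  · rw [abs_mul, abs_pow, abs_neg, abs_one, one_pow, one_mul]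
    exact key _ (negPart_nonneg _) (by
      rw [negPart_def]; exact sup_le (neg_le_abs _) (abs_nonneg _))
  · exact key _ (posPart_nonneg _) (by
      rw [posPart_def]; exact sup_le (le_abs_self _) (abs_nonneg _))

variable {d : ℕ} {I : Fin d → Set ℝ} {n : Fin d → ℕ} {α : Fin d → ℝ} {μ : Measure (Fin d → ℝ)}

lemma integrableOn_prod_splineFactor (hIo : ∀ i, IsOpen (I i)) (hIc : ∀ i, (I i).OrdConnected)
    (hn : ∀ i, 2 ≤ n i) (hα : α ∈ box I) (hμ : ∀ K ⊆ box I, IsCompact K → μ K < ⊤)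
    {x : Fin d → ℝ} (hx : x ∈ box I) :
    IntegrableOn (fun u => ∏ i, splineFactor (n i) (α i) (u i) (x i)) (box I) μ := by
  have hmeas : Measurable fun u : Fin d → ℝ => ∏ i, splineFactor (n i) (α i) (u i) (x i) :=
    Finset.measurable_prod _ fun i _ =>
      (measurable_splineFactor (n i) (α i) (x i)).comp (measurable_pi_apply i)
  set K : Set (Fin d → ℝ) := Set.univ.pi fun i => Set.uIcc (α i) (x i) with hK
  have hKc : IsCompact K := isCompact_univ_pi fun i => isCompact_uIcc
  have hKI : K ⊆ box I := fun u hu i => (hIc i).uIcc_subset (hα i) (hx i) (hu i trivial)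
  have hint : IntegrableOn (fun u => ∏ i, splineFactor (n i) (α i) (u i) (x i)) K μ := by
    refine Measure.integrableOn_of_bounded (hμ K hKI hKc).ne hmeas.aestronglyMeasurable
      (M := ∏ i, |x i - α i| ^ (n i - 1)) ?_
    refine (ae_restrict_iff' hKc.measurableSet).2 (ae_of_all _ fun u hu => ?_)
    rw [Real.norm_eq_abs, Finset.abs_prod]
    exact Finset.prod_le_prod (fun _ _ => abs_nonneg _) fun i _ =>
      abs_splineFactor_le (hu i trivial)
  refine hint.of_forall_sdiff_eq_zero (isOpen_box hIo).measurableSet fun u hu => ?_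
  have : ∃ i, u i ∉ Set.uIcc (α i) (x i) := by
    by_contra! h
    exact hu.2 fun i _ => h i
  obtain ⟨i, hi⟩ := this
  exact Finset.prod_eq_zero (Finset.mem_univ i) (splineFactor_eq_zero (hn i) hi)

lemma measurableSet_orthant (hIo : ∀ i, IsOpen (I i)) (A : Finset (Fin d)) :
    MeasurableSet (orthant I A α) := by
  have : orthant I A α = box I ∩ ((⋂ j ∈ A, {u | u j ≤ α j}) ∩ ⋂ j ∈ Aᶜ, {u | α j < u j}) := by
    ext u
    simp [orthant]
    tauto
  rw [this]
  refine (isOpen_box hIo).measurableSet.inter (.inter ?_ ?_)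
  · exact Finset.measurableSet_biInter _ fun j _ =>
      measurableSet_le (measurable_pi_apply j) measurable_const
  · exact Finset.measurableSet_biInter _ fun j _ =>
      measurableSet_lt measurable_const (measurable_pi_apply j)

lemma splineKernel_eq_prod {A : Finset (Fin d)} {x u : Fin d → ℝ} (hu : u ∈ orthant I A α) :
    splineKernel n A x u = ∏ i, splineFactor (n i) (α i) (u i) (x i) := by
  rw [splineKernel, ← Finset.prod_compl_mul_prod A]
  congr 1
  · exact Finset.prod_congr rfl fun j hj => by
      rw [splineFactor, if_neg (hu.2.2 j (Finset.mem_compl.1 hj)).not_ge]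
  · exact Finset.prod_congr rfl fun j hj => by rw [splineFactor, if_pos (hu.2.1 j hj)]

lemma iUnion_orthant : ⋃ A, orthant I A α = box I := by
  classical
  ext u
  refine ⟨fun h => ?_, fun h => Set.mem_iUnion.2 ⟨Finset.univ.filter fun j => u j ≤ α j, h, ?_, ?_⟩⟩
  · obtain ⟨A, hA⟩ := Set.mem_iUnion.1 h
    exact hA.1
  · simp
  · simp

lemma pairwise_disjoint_orthant :
    Pairwise (Function.onFun Disjoint fun A : Finset (Fin d) => orthant I A α) := by
  intro A B hAB
  refine Set.disjoint_left.2 fun u hA hB => hAB ?_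
  ext j
  constructor
  · intro hj
    by_contra h
    exact (hB.2.2 j h).not_ge (hA.2.1 j hj)
  · intro hj
    by_contra h
    exact (hA.2.2 j h).not_ge (hB.2.1 j hj)

lemma sum_setIntegral_orthant (hIo : ∀ i, IsOpen (I i)) (hIc : ∀ i, (I i).OrdConnected)
    (hn : ∀ i, 2 ≤ n i) (hα : α ∈ box I) (hμ : ∀ K ⊆ box I, IsCompact K → μ K < ⊤)
    {x : Fin d → ℝ} (hx : x ∈ box I) :
    ∑ A : Finset (Fin d), ∫ u in orthant I A α, splineKernel n A x u ∂μ =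
      ∫ u in box I, ∏ i, splineFactor (n i) (α i) (u i) (x i) ∂μ := by
  have hint := integrableOn_prod_splineFactor hIo hIc hn hα hμ hx
  rw [← iUnion_orthant (α := α)] at hint ⊢
  rw [integral_iUnion_fintype (fun A => measurableSet_orthant hIo A) pairwise_disjoint_orthant
    fun A => hint.mono_set (Set.subset_iUnion (fun A => orthant I A α) A)]
  exact Finset.sum_congr rfl fun A _ => setIntegral_congr_fun (measurableSet_orthant hIo A)
    fun u hu => splineKernel_eq_prod hu

lemma multiEval_setIntegral (hIo : ∀ i, IsOpen (I i)) (hIc : ∀ i, (I i).OrdConnected)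
    (hn : ∀ i, 2 ≤ n i) (hα : α ∈ box I) (hμ : ∀ K ⊆ box I, IsCompact K → μ K < ⊤)
    {w : Fin d → ℝ →₀ ℝ} (hw : ∀ i, KillsPoly (n i) (w i)) (hwI : ∀ i, ↑(w i).support ⊆ I i) :
    multiEval w (fun x => ∫ u in box I, ∏ i, splineFactor (n i) (α i) (u i) (x i) ∂μ) =
      ∫ u in box I, ∏ i, pair (w i) (truncPow (n i) (u i)) ∂μ := by
  rw [multiEval_integral _ (fun x (u : Fin d → ℝ) => ∏ i, splineFactor (n i) (α i) (u i) (x i))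
    fun s hs => integrableOn_prod_splineFactor hIo hIc hn hα hμ fun i => hwI i (hs i)]
  refine integral_congr_ae (ae_of_all _ fun u => ?_)
  simp only
  rw [multiEval_prod fun i => splineFactor (n i) (α i) (u i)]
  exact Finset.prod_congr rfl fun i _ => pair_splineFactor (hn i) (hw i) _ _

end BoxConvexity

theorem mainTheorem7 {d : ℕ} (I : Fin d → Set ℝ) (hIopen : ∀ i, IsOpen (I i))
    (hIint : ∀ i, (I i).OrdConnected) (n : Fin d → ℕ) (hn : ∀ i, 2 ≤ n i)
    (f : (Fin d → ℝ) → ℝ) :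
    BoxConvexity.IsBoxConvexOn I n f ↔
      ∀ α ∈ BoxConvexity.box I, ∃ (W : (Fin d → ℝ) → ℝ) (μ : Measure (Fin d → ℝ)),
        BoxConvexity.IsPseudoPolynomialOn I (fun i => (n i : ℤ) - 1) W ∧
        (∀ K ⊆ BoxConvexity.box I, IsCompact K → μ K < ⊤) ∧
        ∀ x ∈ BoxConvexity.box I,
          f x = W x + ∑ A : Finset (Fin d),
            ∫ u in BoxConvexity.orthant I A α, BoxConvexity.splineKernel n A x u ∂μ := by
  open BoxConvexity in
  constructor
  · intro hf α hα
    obtain ⟨μ, hμ, hrep⟩ := hf.exists_measure hIopen hIint hn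
    refine ⟨fun x => f x - ∫ u in box I, ∏ i, splineFactor (n i) (α i) (u i) (x i) ∂μ, μ, ?_, hμ,
      fun x hx => by rw [sum_setIntegral_orthant hIopen hIint hn hα hμ hx]; ring⟩
    have hY : ∀ i, ∃ Y : Finset ℝ, ↑Y ⊆ I i ∧ Y.card = n i := fun i =>
      (infinite_of_mem_nhds (α i) ((hIopen i).mem_nhds (hα i))).exists_subset_card_eq (n i)
    choose Y hYI hYc using hY
    refine isPseudoPolynomialOn_of_multiEval_remainderWeight (fun i => by have := hn i; omega) hYc
      fun x hx => ?_
    have hk : ∀ i, KillsPoly (n i) (remainderWeight (Y i) (x i)) := fun i =>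
      hYc i ▸ killsPoly_remainderWeight (Y i) (x i)
    have hs : ∀ i, ↑(remainderWeight (Y i) (x i)).support ⊆ I i := fun i =>
      (Finset.coe_subset.2 (support_remainderWeight _ _)).trans (by
        rw [Finset.coe_insert]
        exact Set.insert_subset (hx i) (hYI i))
    rw [multiEval_sub, hrep _ hk hs, multiEval_setIntegral hIopen hIint hn hα hμ hk hs, sub_self]
  · intro h x hx hinj
    have hα : (fun i => x i 0) ∈ box I := fun i => hx i 0
    obtain ⟨W, μ, hW, hμ, hf⟩ := h _ hα
    have hc : ∀ i, (Finset.univ.image (x i)).card = n i + 1 := fun i => by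
      rw [Finset.card_image_of_injective _ (hinj i), Finset.card_fin]
    have hk : ∀ i, KillsPoly (n i) (dd (Finset.univ.image (x i))) := fun i => killsPoly_dd (hc i)
    have hs : ∀ i, ↑(dd (Finset.univ.image (x i))).support ⊆ I i := fun i s hs => by
      obtain ⟨j, -, rfl⟩ := Finset.mem_image.1 (support_dd _ hs)
      exact hx i j
    rw [multiDividedDiff_eq_multiEval n x hinj, multiEval_congr (g := fun s => W s +
      ∫ u in box I, ∏ i, splineFactor (n i) (x i 0) (u i) (s i) ∂μ) fun s hsup => by
        have hsb : s ∈ box I := fun i => hs i (hsup i)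
        rw [hf s hsb, sum_setIntegral_orthant hIopen hIint hn hα hμ hsb],
      multiEval_add, multiEval_eq_zero_of_pseudoPolynomial hs hk hW, zero_add,
      multiEval_setIntegral hIopen hIint hn hα hμ hk hs]
    exact integral_nonneg fun u => Finset.prod_nonneg fun i _ =>
      pair_dd_truncPow_nonneg (hn i) (hc i) (u i)
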